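/- Let $\overline{\mathbb R}=(\mathbb R\cup\{\infty\},\min,+)$ be the tropical semiring, and let $S=\overline{\mathbb R}[x_1^{\pm1},\dots,x_n^{\pm1}]$ and $\tilde S=\overline{\mathbb R}[x_0,\dots,x_n]$ be the semirings of (formal) tropical Laurent polynomials and tropical polynomials. Let $K$ be a field with a valuation $\mathrm{val}\colon K\to\mathbb R\cup\{\infty\}$ (possibly trivial). For a (Laurent) polynomial $f=\sum_u c_u x^u$ over $K$ write $\mathrm{trop}(f)=\min_u(\mathrm{val}(c_u)+x\cdot u)$. For an ideal $I$: - $\mathrm{trop}(I)$ is the ideal of $S$ (respectively $\tilde S$) generated by all $\mathrm{trop}(f)$ with $f\in I$. - $\mathcal{T}rop(I)$ is the smallest congruence on $S$ (respectively $\tilde S$) containing the bend relations $\mathrm{trop}(f)\sim\mathrm{trop}(f)_{\hat v}$ for all $f\in I$ and $v\in\mathrm{supp}(f)$, where $F_{\hat v}$ is $F$ with its term at the exponent $v$ removed. - If $I\subset K[x_0,\dots,x_n]$ is homogeneous, let $I_d$ be its degree $d$ part, $M_d$ the set of monomials of degree $d$, and $L_d\subset K^{M_d}$ the subspace of dimension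 $r_d$ on which the linear forms $\sum_u c_u y_u$ vanish for all $\sum_u c_u x^u\in I_d$. The valuated matroid $\mathcal M(I_d)$ is the function $\binom{M_d}{r_d}\to\overline{\mathbb R}$, regarded up to adding a real constant, that sends $B$ to the valuation of the Plücker coordinate of $L_d$ indexed by $B$. - If $I\subset K[x_1^{\pm1},\dots,x_n^{\pm1}]$, its homogenization $I^h\subset K[x_0,\dots,x_n]$ is the ideal generated by the polynomials $\tilde f=\sum_u c_u x^u x_0^{\deg(f)-|u|}$ for $f=\sum_u c_u x^u\in I\cap K[x_1,\dots,x_n]$. **Theorem.** 1. For an ideal $I\subset K[x_1^{\pm1},\dots,x_n^{\pm1}]$, any of the following three objects determines the others: (a) the congruence $\mathcal{T}rop(I)$ on $S$; (b) the ideal $\mathrm{trop}(I)$ in $S$; (c) the family of valuated matroids $\{\mathcal M(I^h_d)\}_{d\ge0}$. 2. For a homogeneous ideal $I\subset K[x_0,\dots,x_n]$, any of the following three objects determines the others: (a) the congruence $\mathcal{T}rop(I)$ on $\tilde S$; (b) the ideal $\mathrm{trop}(I)$ in $\tilde S$; (c) the family of valuated matroids $\{\mathcal M(I_d)\}_{d\ge0}$.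 Here "determines" means: for any two valued fields $K,K'$ (equal or not), and any two ideals $I$ over $K$ and $I'$ over $K'$ of the kind considered, with the same $n$, if one of the three objects is the same for $I$ and $I'$, then so are the other two. -/

import Mathlib

open scoped AddMonoidAlgebra

/-! ### Tropical (Laurent) polynomials -/

/-- The tropical semiring `(ℝ ∪ {∞}, min, +)`; its zero is `∞` and its one is `0`. -/
abbrev TropReal : Type := Tropical (WithTop ℝ)

/-- Laurent polynomials in `x₁, …, xₙ` over `R`. -/
abbrev MvLaurent (n : ℕ) (R : Type*) [Semiring R] : Type _ := AddMonoidAlgebra R (Fin n →₀ ℤ)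

section Tropicalization

variable {K : Type*} [Field K] {M : Type*} [AddCommMonoid M]

/-- The tropicalization of a (Laurent) polynomial: apply the valuation to every coefficient. -/
noncomputable def tropPoly (v : AddValuation K (WithTop ℝ)) (f : AddMonoidAlgebra K M) :
    AddMonoidAlgebra TropReal M :=
  .ofCoeff (f.coeff.mapRange (fun c => Tropical.trop (v c)) (by rw [AddValuation.map_zero]; rfl))

/-- The ideal `trop(I)` generated by the tropicalizations of the elements of `I`. -/
noncomputable def tropIdeal (v : AddValuation K (WithTop ℝ)) (I : Ideal (AddMonoidAlgebra K M)) :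
    Ideal (AddMonoidAlgebra TropReal M) :=
  Ideal.span (tropPoly v '' (I : Set (AddMonoidAlgebra K M)))

/-- `BendRel F P Q` says that `P ∼ Q` is one of the bend relations of `F`: `P = F`, and `Q` is `F`
with the term at some exponent of its support removed. -/
def BendRel (F P Q : AddMonoidAlgebra TropReal M) : Prop :=
  ∃ u ∈ F.coeff.support, P = F ∧ Q = F.erase u

/-- The scheme-theoretic tropicalization of `I`: the smallest congruence containing the bend
relations of the tropicalizations of the elements of `I`. -/
noncomputable def tropCongruence (v : AddValuation K (WithTop ℝ)) (I : Ideal (AddMonoidAlgebra K M)) :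
    RingCon (AddMonoidAlgebra TropReal M) :=
  ringConGen fun P Q => ∃ f ∈ I, BendRel (tropPoly v f) P Q

end Tropicalization

/-! ### Homogenization -/

section Homogenization

variable {n : ℕ} {K : Type*} [Field K]

/-- The inclusion of polynomials in `x₁, …, xₙ` into Laurent polynomials. -/
noncomputable def toMvLaurent : MvPolynomial (Fin n) K →ₐ[K] MvLaurent n K :=
  MvPolynomial.aeval fun i => AddMonoidAlgebra.single (Finsupp.single i (1 : ℤ)) (1 : K)

/-- The homogenization `∑ c_u x^u x₀^(deg f - |u|)` of `f = ∑ c_u x^u`.  The variable `x₀` has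
index `0`, and `x₁, …, xₙ` are shifted by one. -/
noncomputable def homogenization (f : MvPolynomial (Fin n) K) : MvPolynomial (Fin (n + 1)) K :=
  ∑ u ∈ f.support,
    MvPolynomial.monomial (Finsupp.cons (f.totalDegree - u.degree) u) (MvPolynomial.coeff u f)

/-- The homogenization of an ideal of Laurent polynomials, generated by the homogenizations of the
polynomials it contains. -/
noncomputable def homogenizationIdeal (I : Ideal (MvLaurent n K)) :
    Ideal (MvPolynomial (Fin (n + 1)) K) :=
  Ideal.span (homogenization '' {f : MvPolynomial (Fin n) K | toMvLaurent f ∈ I})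

end Homogenization

/-! ### Valuated matroids -/

/-- A valuated matroid on a finite ground set `E`.  Its basis valuation function, defined on the
subsets of size `rank`, is extended by `∞` to all other subsets. -/
structure ValuatedMatroid (E : Type*) [DecidableEq E] where
  rank : ℕ
  val : Finset E → WithTop ℝ
  val_eq_top : ∀ B, B.card ≠ rank → val B = ⊤
  exists_val_ne_top : ∃ B, val B ≠ ⊤
  exchange : ∀ B B', B.card = rank → B'.card = rank → ∀ u ∈ B \ B', ∃ w ∈ B' \ B,
    val (insert w (B.erase u)) + val (insert u (B'.erase w)) ≤ val B + val B'

/-- Two basis valuation functions give the same valuated matroid when they differ by an additive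
real constant (just as Plücker coordinates are homogeneous coordinates). -/
instance ValuatedMatroid.setoid (E : Type*) [DecidableEq E] : Setoid (ValuatedMatroid E) where
  r M N := ∃ a : ℝ, ∀ B, M.val B = (a : WithTop ℝ) + N.val B
  iseqv := by
    refine ⟨fun M => ⟨0, fun B => by simp⟩, ?_, ?_⟩
    · rintro M N ⟨a, h⟩
      refine ⟨-a, fun B => ?_⟩
      rw [h B, ← add_assoc, ← WithTop.coe_add]
      simp
    · rintro M N P ⟨a, h⟩ ⟨b, h'⟩
      refine ⟨a + b, fun B => ?_⟩
      rw [h B, h' B, WithTop.coe_add, add_assoc]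

section Realizable

variable {K : Type*} [Field K] {E : Type*} [DecidableEq E]

/-- The Plücker coordinate at `B` of the span of `b₁, …, b_r` in `K^E`: the maximal minor with
columns `B`.  The columns are enumerated arbitrarily, which only affects the sign; the value is `0`
if `B` does not have size `r`. -/
noncomputable def pluckerCoord {r : ℕ} (b : Fin r → E → K) (B : Finset E) : K :=
  if h : B.card = r then
    (Matrix.of fun i j => b i ((B.equivFinOfCardEq h).symm j : E)).det
  else 0

theorem val_pluckerCoord (v : AddValuation K (WithTop ℝ)) {r : ℕ} (b : Fin r → E → K)
    (e : Fin r → E) (he : Function.Injective e) :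
    v (pluckerCoord b (Finset.univ.image e)) = v (Matrix.of fun i j => b i (e j)).det := by
  have hc : (Finset.univ.image e).card = r := by
    rw [Finset.card_image_of_injective _ he]; simp
  rw [pluckerCoord, dif_pos hc]
  set g := (Finset.univ.image e).equivFinOfCardEq hc
  let s : Fin r → Fin r := fun j => g ⟨e j, Finset.mem_image_of_mem e (Finset.mem_univ j)⟩
  have hs : Function.Injective s := fun i j h => he (by simpa [s] using h)
  let σ : Equiv.Perm (Fin r) := Equiv.ofBijective s (Finite.injective_iff_bijective.1 hs)
  have key : (Matrix.of fun i j => b i (e j)) =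
      (Matrix.of fun i j => b i (g.symm j : E)).submatrix id σ := by
    ext i j
    simp [σ, s]
  rw [key, Matrix.det_permute']
  rcases Int.units_eq_one_or (Equiv.Perm.sign σ) with h | h <;> simp [h, AddValuation.map_neg]

theorem exists_image_eq {r : ℕ} (B : Finset E) (h : B.card = r) :
    ∃ e : Fin r → E, Function.Injective e ∧ Finset.univ.image e = B := by
  refine ⟨fun j => ((B.equivFinOfCardEq h).symm j : E), ?_, ?_⟩
  · exact Subtype.val_injective.comp (Equiv.injective _)
  · ext x
    simp only [Finset.mem_image, Finset.mem_univ, true_and]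
    constructor
    · rintro ⟨j, rfl⟩
      exact Subtype.property _
    · intro hx
      exact ⟨B.equivFinOfCardEq h ⟨x, hx⟩, by simp⟩

theorem image_update {r : ℕ} (e : Fin r → E) (he : Function.Injective e) (j : Fin r) (w : E) :
    Finset.univ.image (Function.update e j w) =
      insert w ((Finset.univ.image e).erase (e j)) := by
  ext x
  simp only [Finset.mem_image, Finset.mem_univ, true_and, Finset.mem_insert, Finset.mem_erase]
  constructor
  · rintro ⟨k, rfl⟩
    by_cases hk : k = j
    · subst hk; simp
    · right
      rw [Function.update_of_ne hk]
      exact ⟨fun h => hk (he h), k, rfl⟩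
  · rintro (rfl | ⟨hx, k, rfl⟩)
    · exact ⟨j, by simp⟩
    · have hk : k ≠ j := fun h => hx (by rw [h])
      exact ⟨k, by rw [Function.update_of_ne hk]⟩

theorem update_injective' {r : ℕ} (e : Fin r → E) (he : Function.Injective e) (j : Fin r) (w : E)
    (hw : w ∉ Finset.univ.image e) : Function.Injective (Function.update e j w) := by
  have hw' : ∀ k, e k ≠ w := fun k h => hw (by simp [← h])
  intro a c h
  by_cases ha : a = j <;> by_cases hc : c = j
  · rw [ha, hc]
  · subst ha
    rw [Function.update_self, Function.update_of_ne hc] at h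
    exact absurd h.symm (hw' c)
  · subst hc
    rw [Function.update_self, Function.update_of_ne ha] at h
    exact absurd h (hw' a)
  · rw [Function.update_of_ne ha, Function.update_of_ne hc] at h
    exact he h

theorem val_pluckerCoord_update (v : AddValuation K (WithTop ℝ)) {r : ℕ} (b : Fin r → E → K)
    (e : Fin r → E) (he : Function.Injective e) (j : Fin r) (w : E)
    (hw : w ∉ Finset.univ.image e) :
    v (pluckerCoord b (insert w ((Finset.univ.image e).erase (e j)))) =
      v (((Matrix.of fun i j => b i (e j)).updateCol j fun i => b i w).det) := by
  rw [← image_update e he j w, val_pluckerCoord v b _ (update_injective' e he j w hw)]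
  congr 2
  ext i k
  by_cases hk : k = j
  · subst hk; simp
  · simp [hk]

theorem det_mul_det_eq_sum {r : ℕ} (A A' : Matrix (Fin r) (Fin r) K) (k : Fin r) :
    A'.det * A.det = ∑ j, (A'.updateCol j fun i => A i k).det *
      (A.updateCol k fun i => A' i j).det := by
  have h1 : A'.det • (fun i => A i k) =
      ∑ j, (A'.updateCol j fun i => A i k).det • fun i => A' i j := by
    rw [← Matrix.mulVec_cramer]
    ext i
    simp [Matrix.mulVec, dotProduct, Matrix.cramer_apply, mul_comm]
  have h2 := congrArg (fun x => Matrix.cramer A x k) h1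
  rw [map_smul, map_sum, Pi.smul_apply, smul_eq_mul, Finset.sum_apply] at h2
  simp only [Matrix.cramer_apply, Matrix.det_updateCol_smul] at h2
  have h3 : (A.updateCol k fun i => A i k) = A := by
    ext i j
    by_cases hj : j = k
    · subst hj; simp
    · simp [hj]
  rwa [h3] at h2

theorem pluckerCoord_exchange (v : AddValuation K (WithTop ℝ)) {r : ℕ} (b : Fin r → E → K)
    (B B' : Finset E) (hB : B.card = r) (hB' : B'.card = r) (u : E) (hu : u ∈ B \ B') :
    ∃ w ∈ B' \ B, v (pluckerCoord b (insert w (B.erase u))) +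
      v (pluckerCoord b (insert u (B'.erase w))) ≤ v (pluckerCoord b B) + v (pluckerCoord b B') := by
  obtain ⟨huB, huB'⟩ := Finset.mem_sdiff.1 hu
  by_cases htop : v (pluckerCoord b B) + v (pluckerCoord b B') = ⊤
  · have hne : (B' \ B).Nonempty := by
      rw [← Finset.card_pos, ← Finset.card_sdiff_comm (hB.trans hB'.symm), Finset.card_pos]
      exact ⟨u, hu⟩
    obtain ⟨w, hw⟩ := hne
    exact ⟨w, hw, by rw [htop]; exact le_top⟩
  · obtain ⟨e, he, rfl⟩ := exists_image_eq B hB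
    obtain ⟨e', he', rfl⟩ := exists_image_eq B' hB'
    obtain ⟨k, -, rfl⟩ := Finset.mem_image.1 huB
    rw [val_pluckerCoord v b e he, val_pluckerCoord v b e' he'] at htop ⊢
    set A : Matrix (Fin r) (Fin r) K := Matrix.of fun i j => b i (e j) with hA
    set A' : Matrix (Fin r) (Fin r) K := Matrix.of fun i j => b i (e' j) with hA'
    have hsum := det_mul_det_eq_sum A A' k
    have hex : ∃ j, v ((A'.updateCol j fun i => A i k).det *
        (A.updateCol k fun i => A' i j).det) ≤ v A.det + v A'.det := by
      by_contra! hlt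
      have := AddValuation.map_lt_sum v htop (s := Finset.univ) (fun j _ => hlt j)
      rw [← hsum, AddValuation.map_mul, add_comm] at this
      exact lt_irrefl _ this
    obtain ⟨j, hj⟩ := hex
    have hjB : e' j ∉ Finset.univ.image e := by
      intro hmem
      obtain ⟨l, -, hl⟩ := Finset.mem_image.1 hmem
      have hlk : l ≠ k := by
        rintro rfl
        exact huB' (by rw [hl]; exact Finset.mem_image_of_mem _ (Finset.mem_univ _))
      have hz : (A.updateCol k fun i => A' i j).det = 0 := by
        refine Matrix.det_zero_of_column_eq hlk fun i => ?_
        simp [hlk, hA, hA', hl]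
      rw [hz, mul_zero, AddValuation.map_zero, top_le_iff] at hj
      exact htop hj
    refine ⟨e' j, Finset.mem_sdiff.2 ⟨Finset.mem_image_of_mem _ (Finset.mem_univ _), hjB⟩, ?_⟩
    rw [val_pluckerCoord_update v b e he k (e' j) hjB,
      val_pluckerCoord_update v b e' he' j (e k) huB', add_comm,
      ← AddValuation.map_mul]
    exact hj

theorem exists_val_pluckerCoord_ne_top [Fintype E] (v : AddValuation K (WithTop ℝ)) {r : ℕ}
    (b : Fin r → E → K) (hb : LinearIndependent K b) : ∃ B, v (pluckerCoord b B) ≠ ⊤ := by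
  have hrank : (Matrix.of b).rank = r := by
    simpa using LinearIndependent.rank_matrix (M := Matrix.of b) hb
  rw [Matrix.rank_eq_finrank_span_cols] at hrank
  obtain ⟨f, hf, -, hli⟩ :=
    Submodule.exists_fun_fin_finrank_span_eq K (Set.range (Matrix.of b).col)
  choose g hg using hf
  have hcol : LinearIndependent K fun j : Fin r => (Matrix.of b).col (g (Fin.cast hrank.symm j)) := by
    simp only [hg]
    exact hli.comp _ (Fin.cast_injective _)
  have hinj : Function.Injective fun j : Fin r => g (Fin.cast hrank.symm j) := fun i j h =>
    hcol.injective (by simpa using congrArg (Matrix.of b).col h)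
  refine ⟨Finset.univ.image fun j : Fin r => g (Fin.cast hrank.symm j), fun h0 => ?_⟩
  rw [val_pluckerCoord v b _ hinj, AddValuation.top_iff] at h0
  have hunit : IsUnit (Matrix.of fun i j : Fin r => b i (g (Fin.cast hrank.symm j))) :=
    Matrix.linearIndependent_cols_iff_isUnit.1 hcol
  exact ((Matrix.isUnit_iff_isUnit_det _).1 hunit).ne_zero h0

/-- The valuated matroid of the span of linearly independent vectors `b₁, …, b_r` in `K^E`: its
basis valuation function is the valuation of the Plücker coordinates. -/
noncomputable def ValuatedMatroid.ofVectors [Fintype E] (v : AddValuation K (WithTop ℝ)) {r : ℕ}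
    (b : Fin r → E → K) (hb : LinearIndependent K b) : ValuatedMatroid E where
  rank := r
  val B := v (pluckerCoord b B)
  val_eq_top B hB := by rw [pluckerCoord, dif_neg hB, AddValuation.map_zero]
  exists_val_ne_top := exists_val_pluckerCoord_ne_top v b hb
  exchange B B' hB hB' u hu := pluckerCoord_exchange v b B B' hB hB' u hu

/-- The valuated matroid, up to an additive real constant in the basis valuation function, of a
linear subspace `L` of `K^E`.  It does not depend on the basis of `L` that is used. -/
noncomputable def subspaceValuatedMatroid [Fintype E] (v : AddValuation K (WithTop ℝ))
    (L : Submodule K (E → K)) : Quotient (ValuatedMatroid.setoid E) :=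
  ⟦ValuatedMatroid.ofVectors v (fun i => (Module.finBasis K L i : E → K))
    ((Module.finBasis K L).linearIndependent.map' L.subtype L.ker_subtype)⟧

end Realizable

/-! ### The valuated matroids of a homogeneous ideal -/

/-- The monomials of degree `d` in `x₀, …, xₙ`, as exponent vectors. -/
abbrev MonomialsOfDegree (n d : ℕ) : Type := {u : Fin (n + 1) →₀ ℕ // u.degree = d}

noncomputable instance (n d : ℕ) : Fintype (MonomialsOfDegree n d) :=
  Fintype.subtype (Finset.finsuppAntidiag Finset.univ d) fun u => by
    simp [Finsupp.degree_eq_sum]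

section Graded

variable {n : ℕ} {K : Type*} [Field K]

/-- The subspace `L_d` of the vectors `y`, with coordinates indexed by the monomials of degree `d`,
on which the linear forms `∑ c_u y_u` given by the elements `f = ∑ c_u x^u` of the degree `d` part
of `I` vanish. -/
def gradedPieceOrthogonal (I : Ideal (MvPolynomial (Fin (n + 1)) K)) (d : ℕ) :
    Submodule K (MonomialsOfDegree n d → K) where
  carrier := {y | ∀ f ∈ I, f.IsHomogeneous d →
    ∑ u : MonomialsOfDegree n d, MvPolynomial.coeff u.1 f * y u = 0}
  zero_mem' := fun f _ _ => by simp
  add_mem' := fun {y z} hy hz f hf hd => by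
    simp [mul_add, Finset.sum_add_distrib, hy f hf hd, hz f hf hd]
  smul_mem' := fun c y hy f hf hd => by
    simp [mul_left_comm _ c, ← Finset.mul_sum, hy f hf hd]

/-- The valuated matroid `M(I_d)` of the degree `d` part of the ideal `I`. -/
noncomputable def gradedValuatedMatroid (v : AddValuation K (WithTop ℝ))
    (I : Ideal (MvPolynomial (Fin (n + 1)) K)) (d : ℕ) :
    Quotient (ValuatedMatroid.setoid (MonomialsOfDegree n d)) :=
  subspaceValuatedMatroid v (gradedPieceOrthogonal I d)

end Graded

attribute [local instance] MvPolynomial.gradedAlgebra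

/-! The heart is finite-dimensional. Let `W` be a subspace of `K^E`, `E` finite, and let the rows
`b` be a basis of `orth W`. Fixing all columns but one in a maximal minor of `b` gives a cocircuit,
a vector of `orth W`; Cramer's rule for `r + 1` columns gives a circuit, a vector of `W`. By
`mem_tropSpan_iff`, a tropical vector is a combination of valuations of vectors of `W` exactly when
it bends at every cocircuit: starting from a basis of least weight, one finds through each point of
its support a rescaled circuit lying above it and touching it there, and the vector is the minimum
of these circuits. So the valuated minors, even up to a constant, determine `tropSpan v W`.
Conversely, `tropSpan v W` shows which sets of columns are independent and, by `eq_smul_circuitVec`,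
each circuit up to scaling, hence the difference of values at adjacent bases; the exchange axiom
connects all bases, so the matroid is recovered.

For an ideal `I`, this is applied to the elements of `I` supported on a finite set of exponents
(`vecs`). Tropical sums cannot cancel, so membership in `tropIdeal v I` can be tested on any finite
set containing the support (`mem_tropIdeal_iff`). Degree by degree, this compares the ideal with the
matroids in the homogeneous case. In the Laurent case, the degree `d` part of the homogenization is
a finite window of `I`, and every Laurent polynomial is moved into such a window by a monomial,
which is a unit.

The congruence is compared with the ideal by duality. The functions `y` on exponents, not
necessarily multiplicative, at which all `tropPoly v f` bend are exactly the linear forms constant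
on congruence classes (`mem_tropZeros_iff`), and an element lies in the ideal exactly when it bends
at all of them (`mem_tropIdeal_iff_bends`), because cocircuits on a finite window extend to linear
forms vanishing on `I`. In the other direction, every element of the ideal satisfies its own bend
relations modulo the congruence (`tropCongruence_erase`). -/

namespace Tropicalization

/-! ### Minimum-weight bases and circuits -/

section Combinatorics

variable {E : Type*}

/-- The descent step for `exists_circuit`. The weight is `P e + ∑ F (e k)`, with infinite entries of
`F` counted separately and compared first. If `F (e j)` is infinite the count drops; otherwise the
count is unchanged and the finite part drops, the other entries contributing equally to both sides.
-/
theorem exists_lt_of_lex_minimal {r : ℕ} (F : E → WithTop ℝ) (P : (Fin r → E) → WithTop ℝ)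
    (e : Fin r → E) (j : Fin r) (x : E) (hP : P (Function.update e j x) ≠ ⊤)
    (hlt : F x + P (Function.update e j x) < F (e j) + P e) :
    toLex (∑ k, (if F (Function.update e j x k) = ⊤ then 1 else 0 : ℕ),
        P (Function.update e j x) +
          ∑ k, ((F (Function.update e j x k)).untopD 0 : ℝ)) <
      toLex (∑ k, (if F (e k) = ⊤ then 1 else 0 : ℕ),
        P e + ∑ k, ((F (e k)).untopD 0 : ℝ)) := by
  have split : ∀ {A : Type} [AddCommMonoid A] (g : E → A) (y : E),
      ∑ k, g (Function.update e j y k) = g y + ∑ k ∈ Finset.univ.erase j, g (e k) := by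
    intro A _ g y
    rw [← Finset.add_sum_erase _ _ (Finset.mem_univ j), Function.update_self]
    congr 1
    exact Finset.sum_congr rfl fun k hk => by
      rw [Function.update_of_ne (Finset.ne_of_mem_erase hk)]
  have split' : ∀ {A : Type} [AddCommMonoid A] (g : E → A),
      ∑ k, g (e k) = g (e j) + ∑ k ∈ Finset.univ.erase j, g (e k) := fun g =>
    (Finset.add_sum_erase _ _ (Finset.mem_univ j)).symm
  have hFx : F x ≠ ⊤ := by
    rintro h
    simp [h] at hlt
  rw [Prod.Lex.toLex_lt_toLex, split (fun y => if F y = ⊤ then 1 else 0),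
    split' (fun y => if F y = ⊤ then 1 else 0),
    split (fun y => (F y).untopD 0), split' (fun y => (F y).untopD 0)]
  by_cases hj : F (e j) = ⊤
  · left
    simp [hj, hFx]
  · right
    refine ⟨by simp [hj, hFx], ?_⟩
    generalize ∑ k ∈ Finset.univ.erase j, (F (e k)).untopD 0 = s
    generalize P (Function.update e j x) = p at *
    generalize P e = q at *
    generalize F x = a at *
    generalize F (e j) = b at *
    lift a to ℝ using hFx
    lift b to ℝ using hj
    lift p to ℝ using hP
    cases q
    · simp [← WithTop.coe_add]
    · simp only [WithTop.untopD_coe]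
      norm_cast at hlt ⊢
      linarith

/-- If a vector `F` bends at all the cocircuits of `P`, then every element of its support lies in a
circuit of `P` that is dominated by `F`. -/
theorem exists_circuit {r : ℕ} [Fintype E] (F : E → WithTop ℝ) (P : (Fin r → E) → WithTop ℝ)
    (hinj : ∀ e, P e ≠ ⊤ → Function.Injective e) (hex : ∃ e, P e ≠ ⊤)
    (hbend : ∀ e j u, F u + P (Function.update e j u) ≠ ⊤ →
      ∃ x, x ≠ u ∧ F x + P (Function.update e j x) ≤ F u + P (Function.update e j u))
    (u : E) (hu : F u ≠ ⊤) :
    ∃ e, P e ≠ ⊤ ∧ (∀ j, e j ≠ u) ∧ ∀ j, F (e j) + P e ≤ F u + P (Function.update e j u) := by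
  classical
  have hne : ∃ e, P e ≠ ⊤ ∧ ∀ j, e j ≠ u := by
    obtain ⟨e, he⟩ := hex
    by_cases h : ∀ j, e j ≠ u
    · exact ⟨e, he, h⟩
    push Not at h
    obtain ⟨j, rfl⟩ := h
    -- A basis through the given point bends at that point, and the second small term trades it for
    -- another element.
    have hfin : F (e j) + P (Function.update e j (e j)) ≠ ⊤ := by
      rw [Function.update_eq_self]
      exact WithTop.add_ne_top.2 ⟨hu, he⟩
    obtain ⟨x, hx, hle⟩ := hbend e j (e j) hfin
    refine ⟨Function.update e j x, ?_, fun k => ?_⟩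
    · exact (WithTop.add_ne_top.1 (ne_top_of_le_ne_top hfin hle)).2
    · by_cases hk : k = j
      · subst hk; simpa using hx
      · rw [Function.update_of_ne hk]
        exact fun h => hk (hinj e he h)
  -- Among the bases avoiding `u`, take one of least weight. Were the inequality false at `j`,
  -- bending at `u` would give an exchange `e j ↦ x` with `x ≠ u` that lowers the weight.
  obtain ⟨e, he, hmin⟩ := Finset.exists_min_image
    (Finset.univ.filter fun e : Fin r → E => P e ≠ ⊤ ∧ ∀ j, e j ≠ u)
    (fun e => toLex (∑ k, (if F (e k) = ⊤ then 1 else 0 : ℕ),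
        P e + ∑ k, ((F (e k)).untopD 0 : ℝ)))
    (by obtain ⟨e, he⟩ := hne; exact ⟨e, by simpa using he⟩)
  simp only [Finset.mem_filter, Finset.mem_univ, true_and] at he hmin
  refine ⟨e, he.1, he.2, fun j => ?_⟩
  by_contra! hlt
  obtain ⟨x, hx, hle⟩ := hbend e j u (ne_top_of_lt hlt)
  have hlt' := hle.trans_lt hlt
  have hP : P (Function.update e j x) ≠ ⊤ := (WithTop.add_ne_top.1 (ne_top_of_lt hlt')).2
  refine absurd (hmin (Function.update e j x) ⟨hP, fun k => ?_⟩)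
    (not_le.2 (exists_lt_of_lex_minimal F P e j x hP hlt'))
  by_cases hk : k = j
  · subst hk; simpa using hx
  · rw [Function.update_of_ne hk]
    exact he.2 k

end Combinatorics

/-! ### The bend condition for tropical linear forms -/

section Bends

variable {X : Type*}

/-- The minimum of the tropical linear form `∑ F_u y_u` is attained at least twice, or is `∞`. -/
def Bends (F y : X → TropReal) : Prop :=
  ∀ u, F u * y u ≠ 0 → ∃ x, x ≠ u ∧ F x * y x ≤ F u * y u

theorem bends_zero (y : X → TropReal) : Bends 0 y := fun u hu => by simp at hu

theorem add_le_left' (a b : TropReal) : a + b ≤ a :=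
  min_le_left a b

theorem add_le_right' (a b : TropReal) : a + b ≤ b :=
  min_le_right a b

theorem mul_le_mul_of_le {a b : TropReal} (h : a ≤ b) (c : TropReal) : c * a ≤ c * b :=
  Tropical.untrop_le_iff.1 (by simpa using add_le_add_right (Tropical.untrop_le_iff.2 h) _)

theorem Bends.add {F G y : X → TropReal} (hF : Bends F y) (hG : Bends G y) : Bends (F + G) y := by
  intro u hu
  rcases le_total (F u) (G u) with h | h
  · have hs : (F + G) u = F u := Tropical.add_eq_left h
    rw [hs] at hu ⊢
    obtain ⟨x, hx, hle⟩ := hF u hu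
    refine ⟨x, hx, le_trans ?_ hle⟩
    rw [mul_comm, mul_comm (F x)]
    exact mul_le_mul_of_le (add_le_left' _ _) _
  · have hs : (F + G) u = G u := Tropical.add_eq_right h
    rw [hs] at hu ⊢
    obtain ⟨x, hx, hle⟩ := hG u hu
    refine ⟨x, hx, le_trans ?_ hle⟩
    rw [mul_comm, mul_comm (G x)]
    exact mul_le_mul_of_le (add_le_right' _ _) _

theorem Bends.smul {F y : X → TropReal} (hF : Bends F y) (c : TropReal) : Bends (c • F) y := by
  intro u hu
  simp only [Pi.smul_apply, smul_eq_mul, mul_assoc] at hu ⊢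
  obtain ⟨x, hx, hle⟩ := hF u (right_ne_zero_of_mul hu)
  exact ⟨x, hx, mul_le_mul_of_le hle c⟩

theorem exists_mul_eq (a : TropReal) {b : TropReal} (hb : b ≠ 0) : ∃ c : TropReal, c * b = a := by
  obtain ⟨x, hx⟩ : ∃ x : ℝ, Tropical.trop (x : WithTop ℝ) = b := by
    induction b using Tropical.tropRec with
    | _ b =>
      cases b
      · exact absurd rfl hb
      · exact ⟨_, rfl⟩
  refine ⟨a * Tropical.trop ((-x : ℝ) : WithTop ℝ), ?_⟩
  rw [← hx, mul_assoc, ← Tropical.trop_add, ← WithTop.coe_add]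
  simp

/-- The case `a = 0` is excluded because the empty sum is `∞`, which is at most `a` only when `a =
∞`. -/
theorem sum_le_iff {ι : Type*} (s : Finset ι) (g : ι → TropReal) {a : TropReal} (ha : a ≠ 0) :
    ∑ x ∈ s, g x ≤ a ↔ ∃ x ∈ s, g x ≤ a := by
  classical
  induction s using Finset.induction_on with
  | empty =>
    simp only [Finset.sum_empty, Finset.notMem_empty, false_and, exists_false, iff_false, not_le]
    exact lt_of_le_of_ne (Tropical.le_zero a) ha
  | insert i s hi ih =>
    rw [Finset.sum_insert hi, Finset.exists_mem_insert, ← ih]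
    exact min_le_iff

/-- A term of strictly smallest valuation would be minus a sum of terms of larger valuation,
contradicting the ultrametric inequality. -/
theorem bends_of_sum_eq_zero {K : Type*} [Field K] (v : AddValuation K (WithTop ℝ))
    (s : Finset X) (w y : X → K) (hs : ∀ x, w x ≠ 0 → x ∈ s) (h : ∑ x ∈ s, w x * y x = 0) :
    Bends (fun x => Tropical.trop (v (w x))) (fun x => Tropical.trop (v (y x))) := by
  classical
  intro u hu
  simp only [← Tropical.trop_add, ← AddValuation.map_mul] at hu ⊢
  have hu' : v (w u * y u) ≠ ⊤ := fun h => hu (congrArg Tropical.trop h)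
  by_contra! hcon
  have hus : u ∈ s := hs u fun h0 => hu' (by simp [h0])
  rw [← Finset.add_sum_erase _ _ hus, add_eq_zero_iff_eq_neg] at h
  have := AddValuation.map_lt_sum v hu' (s := s.erase u) (f := fun x => w x * y x)
    (fun x hx => hcon x (Finset.ne_of_mem_erase hx))
  rw [h, AddValuation.map_neg] at this
  exact lt_irrefl _ this

end Bends

/-! ### Writing a vector as a minimum of vectors above it -/

section Span

variable {E : Type*} [Fintype E]

theorem le_sum {ι : Type*} (s : Finset ι) (g : ι → TropReal) {a : TropReal}
    (h : ∀ i ∈ s, a ≤ g i) : a ≤ ∑ i ∈ s, g i := by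
  classical
  induction s using Finset.induction_on with
  | empty => exact Tropical.le_zero a
  | insert i s hi ih =>
    rw [Finset.sum_insert hi]
    exact le_min (h i (Finset.mem_insert_self _ _))
      (ih fun k hk => h k (Finset.mem_insert_of_mem hk))

/-- `F` is the tropical sum of the chosen vectors `G u`: each lies above `F`, and `G u` touches it
at `u`. -/
theorem mem_of_forall_exists_ge (S : Submodule TropReal (E → TropReal)) (F : E → TropReal)
    (h : ∀ u, F u ≠ 0 → ∃ G ∈ S, G u = F u ∧ ∀ x, F x ≤ G x) : F ∈ S := by
  have h' : ∀ u, ∃ G ∈ S, G u = F u ∧ ∀ x, F x ≤ G x := fun u => by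
    by_cases hu : F u = 0
    · exact ⟨0, S.zero_mem, hu.symm, fun x => Tropical.le_zero _⟩
    · exact h u hu
  choose G hG hGu hle using h'
  have : F = ∑ u, G u := by
    funext x
    rw [Finset.sum_apply]
    refine le_antisymm (le_sum _ _ fun u _ => hle u x) ?_
    classical
    rw [← Finset.add_sum_erase _ _ (Finset.mem_univ x), hGu]
    exact add_le_left' _ _
  rw [this]
  exact S.sum_mem fun u _ => hG u

end Span

/-! ### Maximal minors, cocircuits and circuits -/

section Minors

variable {K : Type*} [Field K] {E : Type*}

/-- The valuation of the maximal minor with columns `e₁, …, e_r`. -/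
noncomputable def minorVal (v : AddValuation K (WithTop ℝ)) {r : ℕ} (b : Fin r → E → K)
    (e : Fin r → E) : WithTop ℝ :=
  v (Matrix.of fun i j => b i (e j)).det

variable {r : ℕ} (b : Fin r → E → K)

theorem injective_of_det_ne_zero {e : Fin r → E}
    (h : (Matrix.of fun i j => b i (e j)).det ≠ 0) : Function.Injective e := by
  intro i j hij
  by_contra hne
  exact h (Matrix.det_zero_of_column_eq hne fun k => by simp [hij])

theorem minorVal_ne_top {v : AddValuation K (WithTop ℝ)} {e : Fin r → E} :
    minorVal v b e ≠ ⊤ ↔ (Matrix.of fun i j => b i (e j)).det ≠ 0 := by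
  rw [minorVal, Ne, AddValuation.top_iff]

theorem det_update (e : Fin r → E) (j : Fin r) (x : E) :
    (Matrix.of fun i k => b i (Function.update e j x k)).det =
      Matrix.cramer (Matrix.of fun i k => b i (e k)) (fun i => b i x) j := by
  rw [Matrix.cramer_apply]
  congr 1
  ext i k
  by_cases hk : k = j
  · subst hk; simp
  · simp [hk]

/-- Expanding the determinant along the variable column `j` writes it as a combination of the rows
`b i`, with coefficients from row `j` of the adjugate. -/
theorem cocircuit_mem_span (e : Fin r → E) (j : Fin r) :
    (fun x => (Matrix.of fun i k => b i (Function.update e j x k)).det) ∈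
      Submodule.span K (Set.range b) := by
  have : (fun x => (Matrix.of fun i k => b i (Function.update e j x k)).det) =
      ∑ i, (Matrix.of fun i k => b i (e k)).adjugate j i • b i := by
    funext x
    rw [det_update, Matrix.cramer_eq_adjugate_mulVec, Finset.sum_apply]
    simp [Matrix.mulVec, dotProduct]
  rw [this]
  exact Submodule.sum_mem _ fun i _ =>
    Submodule.smul_mem _ _ (Submodule.subset_span (Set.mem_range_self i))

open Classical in
/-- The linear relation between the columns `e₁, …, e_r, u` given by Cramer's rule. -/
noncomputable def circuitVec (e : Fin r → E) (u : E) : E → K := fun x =>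
  (if x = u then (Matrix.of fun i k => b i (e k)).det else 0) -
    ∑ j, if x = e j then (Matrix.of fun i k => b i (Function.update e j u k)).det else 0

theorem circuitVec_self {e : Fin r → E} {u : E} (hu : ∀ j, e j ≠ u) :
    circuitVec b e u u = (Matrix.of fun i k => b i (e k)).det := by
  simp [circuitVec, fun j => (hu j).symm]

theorem circuitVec_apply {e : Fin r → E} (he : Function.Injective e) {u : E}
    (hu : ∀ j, e j ≠ u) (j : Fin r) :
    circuitVec b e u (e j) = -(Matrix.of fun i k => b i (Function.update e j u k)).det := by
  simp [circuitVec, hu, he.eq_iff]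

theorem circuitVec_of_ne {e : Fin r → E} {u x : E} (hx : x ≠ u) (hxe : ∀ j, x ≠ e j) :
    circuitVec b e u x = 0 := by
  simp [circuitVec, hx, hxe]

end Minors

/-! ### Orthogonal complements and the tropical span of a subspace -/

section Linear

variable {K : Type*} [Field K] {E : Type*} [Fintype E]

/-- The orthogonal complement with respect to the standard bilinear form. -/
def orth (W : Submodule K (E → K)) : Submodule K (E → K) where
  carrier := {y | ∀ w ∈ W, ∑ e, w e * y e = 0}
  zero_mem' := fun w _ => by simp
  add_mem' := fun hy hz w hw => by simp [mul_add, Finset.sum_add_distrib, hy w hw, hz w hw]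
  smul_mem' := fun c y hy w hw => by simp [mul_left_comm _ c, ← Finset.mul_sum, hy w hw]

theorem orth_orth (W : Submodule K (E → K)) : orth (orth W) = W := by
  classical
  refine le_antisymm (fun w hw => ?_) fun w hw y hy => by
    simpa [mul_comm] using hy w hw
  by_contra hcon
  obtain ⟨φ, hφ, hker⟩ := Submodule.exists_le_ker_of_notMem hcon
  -- The separating functional is pairing with the vector of its values on the standard basis, and
  -- that vector lies in `orth W`.
  have key : ∀ z : E → K, ∑ e, φ (Pi.single e 1) * z e = φ z := fun z => by
    conv_rhs => rw [← Finset.univ_sum_single z]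
    rw [map_sum]
    refine Finset.sum_congr rfl fun e _ => ?_
    rw [mul_comm, ← smul_eq_mul, ← map_smul, ← Pi.single_smul, smul_eq_mul, mul_one]
  refine hφ ?_
  rw [← key]
  exact hw _ fun z hz => by
    have := hker hz
    rw [LinearMap.mem_ker, ← key] at this
    simpa [mul_comm] using this

/-- The coordinatewise valuation of a vector. -/
noncomputable def tropVec (v : AddValuation K (WithTop ℝ)) {X : Type*} (w : X → K) : X → TropReal :=
  fun e => Tropical.trop (v (w e))

/-- The tropical linear span of the coordinatewise valuations of the vectors of a subspace. -/
noncomputable def tropSpan (v : AddValuation K (WithTop ℝ)) (W : Submodule K (E → K)) :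
    Submodule TropReal (E → TropReal) :=
  Submodule.span TropReal (tropVec v '' W)

theorem bends_of_mem_tropSpan (v : AddValuation K (WithTop ℝ)) {W : Submodule K (E → K)}
    {F : E → TropReal} (hF : F ∈ tropSpan v W) {y : E → K} (hy : y ∈ orth W) :
    Bends F (tropVec v y) := by
  induction hF using Submodule.span_induction with
  | mem F hF =>
    obtain ⟨w, hw, rfl⟩ := hF
    exact bends_of_sum_eq_zero v Finset.univ w y (fun _ _ => Finset.mem_univ _) (hy w hw)
  | zero => exact bends_zero _
  | add F G _ _ hF hG => exact hF.add hG
  | smul c F _ hF => exact hF.smul c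

variable {r : ℕ} (b : Fin r → E → K)

/-- Cramer's rule says that the columns of `b`, weighted by `circuitVec`, sum to zero. So the vector
is orthogonal to every `b i`, and `orth_orth` places it in `W`. -/
theorem circuitVec_mem {W : Submodule K (E → K)} (hb : Submodule.span K (Set.range b) = orth W)
    (e : Fin r → E) (u : E) : circuitVec b e u ∈ W := by
  classical
  rw [← orth_orth W, ← hb]
  intro y hy
  induction hy using Submodule.span_induction with
  | mem y hy =>
    obtain ⟨i, rfl⟩ := hy
    have h := congrFun (Matrix.mulVec_cramer (Matrix.of fun i k => b i (e k)) fun i => b i u) i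
    simp only [← det_update, Matrix.mulVec, dotProduct, Matrix.of_apply, Pi.smul_apply,
      smul_eq_mul] at h
    simp only [circuitVec, mul_sub, Finset.sum_sub_distrib, mul_ite, mul_zero, Finset.mul_sum]
    rw [Finset.sum_comm]
    simp [mul_comm (b i u), ← h]
  | zero => simp
  | add y z _ _ hy hz => simp [add_mul, Finset.sum_add_distrib, hy, hz]
  | smul c y _ hy => simp [mul_assoc, ← Finset.mul_sum, hy]

/-- A vector lies in the tropical span of `W` exactly when it bends at the cocircuits of `W`. -/
theorem mem_tropSpan_iff (v : AddValuation K (WithTop ℝ)) {W : Submodule K (E → K)}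
    (hb : Submodule.span K (Set.range b) = orth W) (hex : ∃ e, minorVal v b e ≠ ⊤)
    (F : E → TropReal) :
    F ∈ tropSpan v W ↔
      ∀ e j, Bends F fun x => Tropical.trop (minorVal v b (Function.update e j x)) := by
  refine ⟨fun hF e j => bends_of_mem_tropSpan v hF (hb ▸ cocircuit_mem_span b e j), fun h => ?_⟩
  refine mem_of_forall_exists_ge _ _ fun u hu => ?_
  obtain ⟨e, he, heu, hle⟩ := exists_circuit (fun x => Tropical.untrop (F x)) (minorVal v b)
    (fun e he => injective_of_det_ne_zero b ((minorVal_ne_top b).1 he)) hex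
    (fun e j u hu => h e j u fun h0 => hu (congrArg Tropical.untrop h0)) u
    (fun h0 => hu (congrArg Tropical.trop h0))
  have hinj := injective_of_det_ne_zero b ((minorVal_ne_top b).1 he)
  have hne : tropVec v (circuitVec b e u) u ≠ 0 := by
    rw [tropVec, circuitVec_self b heu]
    exact fun h0 => he (congrArg Tropical.untrop h0)
  -- Rescale the circuit so that it agrees with `F` at `u`.
  obtain ⟨c, hc⟩ := exists_mul_eq (F u) hne
  refine ⟨c • tropVec v (circuitVec b e u), Submodule.smul_mem _ _
    (Submodule.subset_span ⟨_, circuitVec_mem b hb e u, rfl⟩), hc, fun x => ?_⟩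
  by_cases hxu : x = u
  · subst hxu; exact hc.ge
  by_cases hxe : ∃ j, x = e j
  · obtain ⟨j, rfl⟩ := hxe
    have h1 := hle j
    rw [← hc, tropVec, circuitVec_self b heu, Tropical.untrop_mul, Tropical.untrop_trop] at h1
    rw [Pi.smul_apply, tropVec, circuitVec_apply b hinj heu, AddValuation.map_neg, smul_eq_mul]
    -- Both sides contain the finite value `minorVal v b e`; cancelling it leaves the bound of `F`
    -- by the rescaled circuit at `e j`.
    change _ ≤ Tropical.untrop c + minorVal v b e + _ at h1
    rw [add_right_comm] at h1
    exact (WithTop.add_le_add_iff_right he).1 h1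
  · push Not at hxe
    rw [Pi.smul_apply, tropVec, circuitVec_of_ne b hxu hxe, AddValuation.map_zero,
      Tropical.trop_top, smul_zero]
    exact Tropical.le_zero _

end Linear

/-! ### Bases and circuits read off from the tropical span -/

section Determined

variable {K : Type*} [Field K] {E : Type*}

theorem span_range_finBasis [Fintype E] (L : Submodule K (E → K)) :
    Submodule.span K (Set.range fun i => (Module.finBasis K L i : E → K)) = L := by
  have := congrArg (Submodule.map L.subtype) (Module.finBasis K L).span_eq
  rw [Submodule.map_span, ← Set.range_comp, Submodule.map_top, Submodule.range_subtype] at this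
  exact this

/-- No nonzero vector of `T` is supported on `e₁, …, e_m`. -/
def Indep (T : Submodule TropReal (E → TropReal)) {m : ℕ} (e : Fin m → E) : Prop :=
  ∀ F ∈ T, (∀ x, x ∉ Set.range e → F x = 0) → F = 0

theorem tropVec_apply_eq_zero {v : AddValuation K (WithTop ℝ)} {X : Type*} {w : X → K} {x : X} :
    tropVec v w x = 0 ↔ w x = 0 := by
  rw [← AddValuation.top_iff v]
  exact Tropical.trop_injective.eq_iff (b := ⊤)

theorem tropVec_eq_zero {v : AddValuation K (WithTop ℝ)} {X : Type*} {w : X → K} :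
    tropVec v w = 0 ↔ w = 0 := by
  simp only [funext_iff, Pi.zero_apply, tropVec_apply_eq_zero]

/-- Only supports matter: a tropical sum vanishes at a point only if both summands do, so each
vector used in a combination supported on `e` is itself supported there. -/
theorem indep_tropSpan_iff (v : AddValuation K (WithTop ℝ)) (W : Submodule K (E → K)) {m : ℕ}
    (e : Fin m → E) :
    Indep (tropSpan v W) e ↔ ∀ w ∈ W, (∀ x, x ∉ Set.range e → w x = 0) → w = 0 := by
  constructor
  · intro h w hw hx
    rw [← tropVec_eq_zero (v := v)]
    exact h _ (Submodule.subset_span ⟨w, hw, rfl⟩) fun x hxe => tropVec_apply_eq_zero.2 (hx x hxe)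
  · intro h F hF
    induction hF using Submodule.span_induction with
    | mem F hF =>
      obtain ⟨w, hw, rfl⟩ := hF
      intro hx
      rw [tropVec_eq_zero]
      exact h w hw fun x hxe => tropVec_apply_eq_zero.1 (hx x hxe)
    | zero => exact fun _ => rfl
    | add F G _ _ hF hG =>
      intro hx
      have hx' := fun x hxe => Tropical.add_eq_zero_iff.1 (hx x hxe)
      rw [hF fun x hxe => (hx' x hxe).1, hG fun x hxe => (hx' x hxe).2, add_zero]
    | smul c F _ hF =>
      intro hx
      by_cases hc : c = 0
      · rw [hc, zero_smul]
      · rw [hF fun x hxe => (mul_eq_zero.1 (hx x hxe)).resolve_left hc, smul_zero]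

variable [Fintype E] {r : ℕ} (b : Fin r → E → K)

/-- Linear relations among the columns `e j` are the vectors supported on `e` and orthogonal to all
`b i`, and by `orth_orth` these are the vectors of `W` supported on `e`. -/
theorem indep_iff_linearIndependent (v : AddValuation K (WithTop ℝ)) {W : Submodule K (E → K)}
    (hb : Submodule.span K (Set.range b) = orth W) {m : ℕ} {e : Fin m → E}
    (he : Function.Injective e) :
    Indep (tropSpan v W) e ↔ LinearIndependent K fun j i => b i (e j) := by
  classical
  rw [indep_tropSpan_iff, Fintype.linearIndependent_iff]
  constructor
  · intro h g hg j
    have hw : (∑ j, Pi.single (e j) (g j) : E → K) ∈ W := by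
      rw [← orth_orth W, ← hb]
      intro y hy
      induction hy using Submodule.span_induction with
      | mem y hy =>
        obtain ⟨i, rfl⟩ := hy
        have := congrFun hg i
        simp only [Finset.sum_apply, Pi.smul_apply, smul_eq_mul, Pi.zero_apply] at this
        simp only [Finset.sum_apply, Finset.mul_sum]
        rw [Finset.sum_comm, ← this]
        simp [Pi.single_apply, mul_comm]
      | zero => simp
      | add y z _ _ hy hz => simp only [Pi.add_apply, add_mul, Finset.sum_add_distrib, hy, hz,
          add_zero]
      | smul c y _ hy => simp only [Pi.smul_apply, smul_eq_mul, mul_assoc, ← Finset.mul_sum, hy,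
          mul_zero]
    have h0 := congrFun (h _ hw fun x hx => by
      rw [Finset.sum_apply]
      exact Finset.sum_eq_zero fun j _ => Pi.single_eq_of_ne (fun h => hx ⟨j, h.symm⟩) _) (e j)
    simpa [Pi.single_apply, he.eq_iff] using h0
  · intro h w hw hx
    have h0 := h (fun j => w (e j)) (by
      funext i
      rw [Finset.sum_apply, Pi.zero_apply]
      have hbi : b i ∈ orth W := hb ▸ Submodule.subset_span (Set.mem_range_self i)
      rw [← hbi w hw]
      refine Finset.sum_of_injOn e he.injOn (fun _ _ => Finset.mem_coe.2 (Finset.mem_univ _))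
        (fun x _ hxe => ?_) fun j _ => rfl
      rw [hx x fun ⟨j, hj⟩ => hxe ⟨j, by simp, hj⟩, zero_mul])
    funext x
    by_cases hxe : x ∈ Set.range e
    · obtain ⟨j, rfl⟩ := hxe
      exact h0 j
    · exact hx x hxe

theorem indep_iff_minorVal_ne_top (v : AddValuation K (WithTop ℝ)) {W : Submodule K (E → K)}
    (hb : Submodule.span K (Set.range b) = orth W) {e : Fin r → E}
    (he : Function.Injective e) :
    Indep (tropSpan v W) e ↔ minorVal v b e ≠ ⊤ := by
  rw [indep_iff_linearIndependent b v hb he, minorVal_ne_top, ← isUnit_iff_ne_zero,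
    ← Matrix.isUnit_iff_isUnit_det, ← Matrix.linearIndependent_cols_iff_isUnit]
  rfl

/-- The vectors of the tropical span supported on a circuit are the multiples of that circuit. -/
theorem eq_smul_circuitVec (v : AddValuation K (WithTop ℝ)) {W : Submodule K (E → K)}
    (hb : Submodule.span K (Set.range b) = orth W) {e : Fin r → E} (he : minorVal v b e ≠ ⊤)
    {u : E} (hu : ∀ j, e j ≠ u) {F : E → TropReal} (hF : F ∈ tropSpan v W)
    (hx : ∀ x, x ≠ u → x ∉ Set.range e → F x = 0) :
    ∃ c : TropReal, F = c • tropVec v (circuitVec b e u) := by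
  have hdet := (minorVal_ne_top b).1 he
  have hind := (indep_tropSpan_iff v W e).1
    ((indep_iff_minorVal_ne_top b v hb (injective_of_det_ne_zero b hdet)).2 he)
  induction hF using Submodule.span_induction with
  | mem F hF =>
    obtain ⟨w, hw, rfl⟩ := hF
    -- Subtracting the multiple of the circuit that kills the coordinate `u` leaves a vector of `W`
    -- supported on the basis `e`, hence zero.
    have hw0 := hind (w - (w u / (Matrix.of fun i k => b i (e k)).det) • circuitVec b e u)
      (W.sub_mem hw (W.smul_mem _ (circuitVec_mem b hb e u))) fun x hxe => by
        by_cases hxu : x = u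
        · subst hxu
          simp [circuitVec_self b hu, hdet]
        · rw [Pi.sub_apply, Pi.smul_apply,
            circuitVec_of_ne b hxu fun j h => hxe ⟨j, h.symm⟩, smul_zero,
            tropVec_apply_eq_zero.1 (hx x hxu hxe), sub_zero]
    refine ⟨Tropical.trop (v (w u / (Matrix.of fun i k => b i (e k)).det)), ?_⟩
    funext x
    have := congrFun (sub_eq_zero.1 hw0) x
    rw [tropVec, this, Pi.smul_apply, smul_eq_mul, AddValuation.map_mul, Tropical.trop_add]
    rfl
  | zero => exact ⟨0, by simp⟩
  | add F G _ _ hF hG =>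
    have hx' := fun x hxu hxe => Tropical.add_eq_zero_iff.1 (hx x hxu hxe)
    obtain ⟨c, rfl⟩ := hF fun x hxu hxe => (hx' x hxu hxe).1
    obtain ⟨d, rfl⟩ := hG fun x hxu hxe => (hx' x hxu hxe).2
    exact ⟨c + d, (add_smul _ _ _).symm⟩
  | smul c F _ hF =>
    by_cases hc : c = 0
    · exact ⟨0, by rw [hc, zero_smul, zero_smul]⟩
    · obtain ⟨d, rfl⟩ := hF fun x hxu hxe => (mul_eq_zero.1 (hx x hxu hxe)).resolve_left hc
      exact ⟨c * d, (mul_smul _ _ _).symm⟩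

end Determined

/-! ### Valuated matroids determined by adjacent bases -/

section Matroid

variable {E : Type*} [DecidableEq E]

/-- A valuated matroid is determined by its bases and by the differences of the values at adjacent
bases. -/
theorem equiv_of_adjacent (M N : ValuatedMatroid E) 
    (htop : ∀ B, M.val B = ⊤ ↔ N.val B = ⊤)
    (hadj : ∀ B, ∀ u ∈ B, ∀ w ∉ B, M.val B ≠ ⊤ →
      M.val (insert w (B.erase u)) + N.val B = M.val B + N.val (insert w (B.erase u))) :
    M ≈ N := by
  have hcard : ∀ B, M.val B ≠ ⊤ → B.card = M.rank := fun B hB => by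
    by_contra h
    exact hB (M.val_eq_top B h)
  obtain ⟨B₀, hB₀⟩ := M.exists_val_ne_top
  have hB₀' := mt (htop B₀).2 hB₀
  obtain ⟨a, ha⟩ : ∃ a : ℝ, M.val B₀ = a + N.val B₀ := by
    lift M.val B₀ to ℝ using hB₀ with x
    lift N.val B₀ to ℝ using hB₀' with y
    exact ⟨x - y, by rw [← WithTop.coe_add, sub_add_cancel]⟩
  -- Induction on the distance to `B₀`: the exchange axiom moves `B` one step towards `B₀`, and
  -- `hadj` carries the constant `a` back along that step.
  have key : ∀ k B, (B \ B₀).card = k → M.val B ≠ ⊤ → M.val B = a + N.val B := by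
    intro k
    induction k with
    | zero =>
      intro B hk hB
      rw [Finset.card_eq_zero, Finset.sdiff_eq_empty_iff_subset] at hk
      rw [Finset.eq_of_subset_of_card_le hk (by rw [hcard B hB, hcard B₀ hB₀])]
      exact ha
    | succ k ih =>
      intro B hk hB
      obtain ⟨u, hu⟩ : (B \ B₀).Nonempty := by rw [← Finset.card_pos, hk]; omega
      obtain ⟨w, hw, hle⟩ := M.exchange B B₀ (hcard B hB) (hcard B₀ hB₀) u hu
      rw [Finset.mem_sdiff] at hu hw
      -- The exchange inequality has a finite right-hand side, so the exchanged set is again a basis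
      -- of `M`.
      have hB₁ := (WithTop.add_ne_top.1
        (ne_top_of_le_ne_top (WithTop.add_ne_top.2 ⟨hB, hB₀⟩) hle)).1
      have hsd : insert w (B.erase u) \ B₀ = (B \ B₀).erase u := by
        ext x
        simp only [Finset.mem_sdiff, Finset.mem_insert, Finset.mem_erase]
        constructor
        · rintro ⟨rfl | h, h'⟩
          · exact absurd hw.1 h'
          · exact ⟨h.1, h.2, h'⟩
        · rintro ⟨h, h', h''⟩
          exact ⟨Or.inr ⟨h, h'⟩, h''⟩
      have h1 := ih (insert w (B.erase u))
        (by rw [hsd, Finset.card_erase_of_mem (Finset.mem_sdiff.2 hu), hk]; rfl) hB₁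
      have h2 := hadj B u hu.1 w hw.2 hB
      rw [h1, add_right_comm] at h2
      exact ((WithTop.add_right_inj (mt (htop _).2 hB₁)).1 h2).symm
  refine ⟨a, fun B => ?_⟩
  by_cases hB : M.val B = ⊤
  · rw [hB, (htop B).1 hB, WithTop.add_top]
  · exact key _ B rfl hB

end Matroid

/-! ### Equivalence of the valuated matroid and the tropical span -/

section Linear

variable {K K' : Type*} [Field K] [Field K'] {E : Type*} [Fintype E] [DecidableEq E]
  {v : AddValuation K (WithTop ℝ)} {v' : AddValuation K' (WithTop ℝ)}

theorem val_ofVectors_image {r : ℕ} {b : Fin r → E → K} (hli : LinearIndependent K b)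
    {e : Fin r → E} (he : Function.Injective e) :
    (ValuatedMatroid.ofVectors v b hli).val (Finset.univ.image e) = minorVal v b e :=
  val_pluckerCoord v b e he

theorem exists_minorVal_ne_top {r : ℕ} {b : Fin r → E → K} (hli : LinearIndependent K b) :
    ∃ e, minorVal v b e ≠ ⊤ := by
  obtain ⟨B, hB⟩ := (ValuatedMatroid.ofVectors v b hli).exists_val_ne_top
  have hcard : B.card = r := by
    by_contra h
    exact hB ((ValuatedMatroid.ofVectors v b hli).val_eq_top B h)
  obtain ⟨e, he, rfl⟩ := exists_image_eq B hcard
  exact ⟨e, val_ofVectors_image hli he ▸ hB⟩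

variable {W : Submodule K (E → K)} {W' : Submodule K' (E → K')}

/-- The cocircuits of the two subspaces have the same valuations up to the common constant `a`,
which does not affect bending; `mem_tropSpan_iff` then describes both spans by the same conditions.
-/
theorem tropSpan_eq_of_matroid_equiv {r r' : ℕ} {b : Fin r → E → K} {b' : Fin r' → E → K'}
    (hb : Submodule.span K (Set.range b) = orth W)
    (hb' : Submodule.span K' (Set.range b') = orth W') (hli : LinearIndependent K b)
    (hli' : LinearIndependent K' b')
    (h : ValuatedMatroid.ofVectors v b hli ≈ ValuatedMatroid.ofVectors v' b' hli') :
    tropSpan v W = tropSpan v' W' := by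
  obtain ⟨a, ha⟩ := h
  -- A set with a finite value for both functions has both ranks as its cardinality.
  have hr : r = r' := by
    obtain ⟨B, hB⟩ := (ValuatedMatroid.ofVectors v b hli).exists_val_ne_top
    have hB' : (ValuatedMatroid.ofVectors v' b' hli').val B ≠ ⊤ := fun h0 => hB (by
      rw [ha, h0, WithTop.add_top])
    exact (not_not.1 fun h => hB (ValuatedMatroid.val_eq_top _ B h)).symm.trans
      (not_not.1 fun h => hB' (ValuatedMatroid.val_eq_top _ B h))
  subst hr
  have hminor : ∀ e, minorVal v b e = a + minorVal v' b' e := fun e => by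
    by_cases he : Function.Injective e
    · rw [← val_ofVectors_image hli he, ← val_ofVectors_image hli' he, ha]
    · rw [not_not.1 fun h => he (injective_of_det_ne_zero b ((minorVal_ne_top b).1 h)),
        not_not.1 fun h => he (injective_of_det_ne_zero b' ((minorVal_ne_top b').1 h)),
        WithTop.add_top]
  ext F
  rw [mem_tropSpan_iff b v hb (exists_minorVal_ne_top hli),
    mem_tropSpan_iff b' v' hb' (exists_minorVal_ne_top hli')]
  refine forall_congr' fun e => forall_congr' fun j => ?_
  have hne : Tropical.trop (a : WithTop ℝ) ≠ 0 := Tropical.trop_coe_ne_zero a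
  simp only [Bends, hminor, Tropical.trop_add, mul_left_comm _ (Tropical.trop (a : WithTop ℝ)),
    mul_ne_zero_iff, ne_eq, hne, not_false_eq_true, true_and]
  refine forall_congr' fun u => forall_congr' fun _ => exists_congr fun x =>
    and_congr_right fun _ => ?_
  exact WithTop.add_le_add_iff_left WithTop.coe_ne_top

/-- A basis for `b'` is independent for the common span, so it gives `r'` linearly independent
columns in `K^r`. -/
theorem rank_le_of_tropSpan_eq {r r' : ℕ} {b : Fin r → E → K} {b' : Fin r' → E → K'}
    (hb : Submodule.span K (Set.range b) = orth W)
    (hb' : Submodule.span K' (Set.range b') = orth W')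
    (hli' : LinearIndependent K' b') (hT : tropSpan v W = tropSpan v' W') : r' ≤ r := by
  obtain ⟨e, he⟩ := exists_minorVal_ne_top (v := v') hli'
  have hinj := injective_of_det_ne_zero b' ((minorVal_ne_top b').1 he)
  have h1 := (indep_iff_minorVal_ne_top b' v' hb' hinj).2 he
  rw [← hT, indep_iff_linearIndependent b v hb hinj] at h1
  simpa using h1.fintype_card_le_finrank

/-- Independence in the common span identifies the bases. The circuit on `e` and `w` has, up to
sign, the minors of two adjacent bases as its entries at `w` and `e j`, and it is known up to
scaling, so the difference of their valuations is known. -/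
theorem matroid_equiv_of_tropSpan_eq {r r' : ℕ} {b : Fin r → E → K} {b' : Fin r' → E → K'}
    (hb : Submodule.span K (Set.range b) = orth W)
    (hb' : Submodule.span K' (Set.range b') = orth W') (hli : LinearIndependent K b)
    (hli' : LinearIndependent K' b') (hT : tropSpan v W = tropSpan v' W') :
    ValuatedMatroid.ofVectors v b hli ≈ ValuatedMatroid.ofVectors v' b' hli' := by
  obtain rfl : r = r' := le_antisymm (rank_le_of_tropSpan_eq hb' hb hli hT.symm)
    (rank_le_of_tropSpan_eq hb hb' hli' hT)
  have htop : ∀ e, Function.Injective e → (minorVal v b e ≠ ⊤ ↔ minorVal v' b' e ≠ ⊤) :=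
    fun e he => by
      rw [← indep_iff_minorVal_ne_top b v hb he, hT, indep_iff_minorVal_ne_top b' v' hb' he]
  refine equiv_of_adjacent _ _ (fun B => ?_) fun B u hu w hw hB => ?_
  · by_cases hB : B.card = r
    · obtain ⟨e, he, rfl⟩ := exists_image_eq B hB
      rw [val_ofVectors_image hli he, val_ofVectors_image hli' he]
      exact not_iff_not.1 (htop e he)
    · rw [ValuatedMatroid.val_eq_top _ B hB, ValuatedMatroid.val_eq_top _ B hB]
  · have hcard : B.card = r := not_not.1 fun h => hB (ValuatedMatroid.val_eq_top _ B h)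
    obtain ⟨e, he, rfl⟩ := exists_image_eq B hcard
    obtain ⟨j, -, rfl⟩ := Finset.mem_image.1 hu
    have hew : ∀ k, e k ≠ w := fun k hk => hw (hk ▸ Finset.mem_image_of_mem e (Finset.mem_univ k))
    have hup := update_injective' e he j w hw
    rw [← image_update e he, val_ofVectors_image hli he, val_ofVectors_image hli' he,
      val_ofVectors_image hli hup, val_ofVectors_image hli' hup]
    rw [val_ofVectors_image hli he] at hB
    -- The circuit over `K` lies in the span for `K'`, hence is a multiple of the circuit over `K'`;
    -- comparing entries at `w` and `e j` eliminates the factor `c`.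
    obtain ⟨c, hc⟩ := eq_smul_circuitVec b' v' hb' ((htop e he).1 hB) hew
      (F := tropVec v (circuitVec b e w))
      (hT ▸ Submodule.subset_span ⟨_, circuitVec_mem b hb e w, rfl⟩) fun x hxw hxe =>
        tropVec_apply_eq_zero.2 (circuitVec_of_ne b hxw fun k h => hxe ⟨k, h.symm⟩)
    have h1 := congrArg Tropical.untrop (congrFun hc w)
    have h2 := congrArg Tropical.untrop (congrFun hc (e j))
    simp only [tropVec, Pi.smul_apply, smul_eq_mul, Tropical.untrop_mul, Tropical.untrop_trop,
      circuitVec_self b hew, circuitVec_self b' hew, circuitVec_apply b he hew,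
      circuitVec_apply b' he hew, AddValuation.map_neg] at h1 h2
    rw [minorVal, minorVal, minorVal, minorVal, h1, h2]
    abel

/-- The tropical span of a subspace and the valuated matroid of its orthogonal complement determine
each other. -/
theorem subspaceValuatedMatroid_orth_eq_iff :
    subspaceValuatedMatroid v (orth W) = subspaceValuatedMatroid v' (orth W') ↔
      tropSpan v W = tropSpan v' W' := by
  rw [subspaceValuatedMatroid, subspaceValuatedMatroid, Quotient.eq]
  exact ⟨tropSpan_eq_of_matroid_equiv (span_range_finBasis _) (span_range_finBasis _) _ _,
    matroid_equiv_of_tropSpan_eq (span_range_finBasis _) (span_range_finBasis _) _ _⟩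

end Linear

/-! ### Polynomials with exponents in a finite window -/

section Coordinates

variable {M : Type*} {E : Type*} [Fintype E]

/-- The element `∑ w_e x^(ι e)` with coefficient vector `w`. -/
noncomputable def ofVec (R : Type*) [Semiring R] (ι : E → M) : (E → R) →ₗ[R] AddMonoidAlgebra R M where
  toFun w := ∑ e, AddMonoidAlgebra.single (ι e) (w e)
  map_add' w z := by simp [Finset.sum_add_distrib]
  map_smul' c w := by simp [Finset.smul_sum]

theorem ofVec_apply {R : Type*} [Semiring R] (ι : E → M) (w : E → R) :
    ofVec R ι w = ∑ e, AddMonoidAlgebra.single (ι e) (w e) := rfl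

theorem coeff_ofVec {R : Type*} [Semiring R] {ι : E → M} (hι : Function.Injective ι) (w : E → R)
    (e : E) : (ofVec R ι w).coeff (ι e) = w e := by
  classical
  simp [ofVec_apply, Finsupp.single_apply, hι.eq_iff]

theorem coeff_ofVec_of_notMem {R : Type*} [Semiring R] {ι : E → M} (w : E → R)
    {x : M} (hx : x ∉ Set.range ι) : (ofVec R ι w).coeff x = 0 := by
  classical
  rw [ofVec_apply, AddMonoidAlgebra.coeff_sum, Finsupp.finsetSum_apply]
  exact Finset.sum_eq_zero fun e _ => Finsupp.single_eq_of_ne fun h => hx ⟨e, h.symm⟩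

theorem ofVec_coeff {R : Type*} [Semiring R] {ι : E → M} (hι : Function.Injective ι)
    {F : AddMonoidAlgebra R M} (hF : ∀ x, x ∉ Set.range ι → F.coeff x = 0) :
    ofVec R ι (fun e => F.coeff (ι e)) = F := by
  ext x
  by_cases hx : x ∈ Set.range ι
  · obtain ⟨e, rfl⟩ := hx
    rw [coeff_ofVec hι]
  · rw [coeff_ofVec_of_notMem _ hx, hF x hx]

end Coordinates

/-! ### Tropical ideals on finite windows and their zeros -/

section Ideals

variable {K : Type*} [Field K] {M : Type*} (v : AddValuation K (WithTop ℝ))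

theorem coeff_tropPoly (f : AddMonoidAlgebra K M) (u : M) :
    (tropPoly v f).coeff u = Tropical.trop (v (f.coeff u)) := by
  simp [tropPoly]

theorem coeff_tropPoly_eq_zero {f : AddMonoidAlgebra K M} {u : M} :
    (tropPoly v f).coeff u = 0 ↔ f.coeff u = 0 := by
  rw [coeff_tropPoly]
  exact tropVec_apply_eq_zero (w := f.coeff)

theorem tropPoly_ofVec {E : Type*} [Fintype E] {ι : E → M} (hι : Function.Injective ι)
    (w : E → K) : tropPoly v (ofVec K ι w) = ofVec TropReal ι (tropVec v w) := by
  ext x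
  rw [coeff_tropPoly]
  by_cases hx : x ∈ Set.range ι
  · obtain ⟨e, rfl⟩ := hx
    rw [coeff_ofVec hι, coeff_ofVec hι, tropVec]
  · rw [coeff_ofVec_of_notMem _ hx, coeff_ofVec_of_notMem _ hx, AddValuation.map_zero,
      Tropical.trop_top]

theorem coeff_eq_zero_of_add {X : Type*} {F G : X →₀ TropReal} {x : X} (h : (F + G) x = 0) :
    F x = 0 ∧ G x = 0 :=
  Tropical.add_eq_zero_iff.1 h

variable [AddCommMonoid M]

/-- The coefficient vectors of the elements of `I` supported on the image of `ι`. -/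
noncomputable def vecs (I : Ideal (AddMonoidAlgebra K M)) {E : Type*} [Fintype E] (ι : E → M) :
    Submodule K (E → K) :=
  (I.restrictScalars K).comap (ofVec K ι)

theorem mem_vecs {I : Ideal (AddMonoidAlgebra K M)} {E : Type*} [Fintype E] {ι : E → M}
    {w : E → K} : w ∈ vecs I ι ↔ ofVec K ι w ∈ I := Iff.rfl

/-- `K^E` modulo `vecs I ι` embeds in the quotient of the whole algebra by `I`. The functional given
by `z` descends to the smaller space and extends along a left inverse of the embedding. -/
theorem exists_extension {I : Ideal (AddMonoidAlgebra K M)} {E : Type*} [Fintype E] {ι : E → M}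
    {z : E → K} (hz : z ∈ orth (vecs I ι)) :
    ∃ y : M → K, (∀ e, y (ι e) = z e) ∧ ∀ f ∈ I, ∑ u ∈ f.coeff.support, f.coeff u * y u = 0 := by
  classical
  let J := I.restrictScalars K
  let P := J.comap (ofVec K ι)
  let φ : (E → K) →ₗ[K] K := ∑ e, z e • LinearMap.proj e
  have hφ : ∀ w, φ w = ∑ e, w e * z e := fun w => by simp [φ, mul_comm]
  have hP : P ≤ φ.ker := fun w hw => by
    rw [LinearMap.mem_ker, hφ]
    exact hz w hw
  obtain ⟨g, hg⟩ := LinearMap.exists_leftInverse_of_injective (P.mapQ J (ofVec K ι) le_rfl) (by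
    rw [Submodule.ker_mapQ]
    exact Submodule.mkQ_map_self P)
  let ψ : AddMonoidAlgebra K M →ₗ[K] K := P.liftQ φ hP ∘ₗ g ∘ₗ J.mkQ
  have hψ : ∀ w, ψ (ofVec K ι w) = φ w := fun w => by
    have h1 := LinearMap.congr_fun hg (P.mkQ w)
    simp only [LinearMap.comp_apply, Submodule.mkQ_apply, Submodule.mapQ_apply,
      LinearMap.id_apply] at h1
    simp only [ψ, LinearMap.comp_apply, Submodule.mkQ_apply, h1, Submodule.liftQ_apply]
  refine ⟨fun u => ψ (AddMonoidAlgebra.single u 1), fun e => ?_, fun f hf => ?_⟩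
  · have h1 := hψ (Pi.single e 1)
    rw [hφ, ofVec_apply, Finset.sum_eq_single e (fun x _ hx => by simp [hx]) (by simp),
      Pi.single_eq_same] at h1
    simpa [Pi.single_apply] using h1
  · have h0 : ψ f = 0 := by
      have : J.mkQ f = 0 := (Submodule.Quotient.mk_eq_zero J).2 hf
      simp only [ψ, LinearMap.comp_apply, this, map_zero]
    have hsum : f = ∑ u ∈ f.coeff.support, f.coeff u • AddMonoidAlgebra.single u (1 : K) := by
      ext x
      simp [Finsupp.single_apply, eq_comm]
    rw [hsum, map_sum] at h0
    simpa only [map_smul, smul_eq_mul] using h0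

theorem single_mul_eq_smul {R : Type*} [CommSemiring R] (a : M) (r : R)
    (F : AddMonoidAlgebra R M) : AddMonoidAlgebra.single a r * F =
      r • (AddMonoidAlgebra.single a 1 * F) := by
  rw [← smul_mul_assoc, AddMonoidAlgebra.smul_single, smul_eq_mul, mul_one]

theorem ofVec_mem_tropIdeal {I : Ideal (AddMonoidAlgebra K M)} {E : Type*} [Fintype E] {ι : E → M}
    (hι : Function.Injective ι) {G : E → TropReal} (hG : G ∈ tropSpan v (vecs I ι)) :
    ofVec TropReal ι G ∈ tropIdeal v I := by
  have : tropSpan v (vecs I ι) ≤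
      ((tropIdeal v I).restrictScalars TropReal).comap (ofVec TropReal ι) := by
    refine Submodule.span_le.2 ?_
    rintro _ ⟨w, hw, rfl⟩
    exact Submodule.subset_span ⟨_, hw, tropPoly_ofVec v hι w⟩
  exact this hG

variable [IsCancelAdd M]

theorem tropPoly_single_mul (a : M) (f : AddMonoidAlgebra K M) :
    tropPoly v (AddMonoidAlgebra.single a 1 * f) =
      AddMonoidAlgebra.single a 1 * tropPoly v f := by
  ext x
  rw [coeff_tropPoly]
  by_cases hx : ∃ u, a + u = x
  · obtain ⟨u, rfl⟩ := hx
    rw [AddMonoidAlgebra.coeff_single_mul_add, AddMonoidAlgebra.coeff_single_mul_add,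
      coeff_tropPoly, one_mul, one_mul]
  · push Not at hx
    rw [AddMonoidAlgebra.coeff_single_mul_of_forall_add_ne _ _ hx,
      AddMonoidAlgebra.coeff_single_mul_of_forall_add_ne _ _ hx, AddValuation.map_zero,
      Tropical.trop_top]

/-- Multiplication by a monomial shifts exponents without merging them, so it commutes with
`tropPoly`. As `I` is stable under it, the linear span of the tropicalizations is already an ideal.
-/
theorem mem_tropIdeal_iff_span {I : Ideal (AddMonoidAlgebra K M)}
    {F : AddMonoidAlgebra TropReal M} :
    F ∈ tropIdeal v I ↔ F ∈ Submodule.span TropReal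
      (tropPoly v '' (I : Set (AddMonoidAlgebra K M))) := by
  constructor
  · intro h
    induction h using Submodule.span_induction with
    | mem F hF => exact Submodule.subset_span hF
    | zero => exact Submodule.zero_mem _
    | add F G _ _ hF hG => exact Submodule.add_mem _ hF hG
    | smul s F hmem hF =>
      clear hmem
      rw [smul_eq_mul]
      induction s using AddMonoidAlgebra.induction_linear with
      | zero => rw [zero_mul]; exact Submodule.zero_mem _
      | add s t hs ht => rw [add_mul]; exact Submodule.add_mem _ hs ht
      | single a r =>
        rw [single_mul_eq_smul]
        refine Submodule.smul_mem _ _ ?_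
        induction hF using Submodule.span_induction with
        | mem F hF =>
          obtain ⟨f, hf, rfl⟩ := hF
          exact Submodule.subset_span ⟨_, I.mul_mem_left _ hf, tropPoly_single_mul v a f⟩
        | zero => rw [mul_zero]; exact Submodule.zero_mem _
        | add F G _ _ hF hG => rw [mul_add]; exact Submodule.add_mem _ hF hG
        | smul c F _ hF => rw [mul_smul_comm]; exact Submodule.smul_mem _ _ hF
  · intro h
    have : Submodule.span TropReal (tropPoly v '' (I : Set (AddMonoidAlgebra K M))) ≤
        (tropIdeal v I).restrictScalars TropReal := Submodule.span_le.2 Submodule.subset_span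
    exact this h

/-- Without cancellation, a combination supported on the window uses, with nonzero coefficients,
only elements supported on the window. -/
theorem coeff_mem_tropSpan {I : Ideal (AddMonoidAlgebra K M)} {E : Type*} [Fintype E] {ι : E → M}
    (hι : Function.Injective ι) {F : AddMonoidAlgebra TropReal M} (hF : F ∈ tropIdeal v I)
    (hx : ∀ x, x ∉ Set.range ι → F.coeff x = 0) :
    (fun e => F.coeff (ι e)) ∈ tropSpan v (vecs I ι) := by
  rw [mem_tropIdeal_iff_span] at hF
  induction hF using Submodule.span_induction with
  | mem F hF =>
    obtain ⟨f, hf, rfl⟩ := hF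
    refine Submodule.subset_span ⟨fun e => f.coeff (ι e), ?_, ?_⟩
    · rw [SetLike.mem_coe, mem_vecs, ofVec_coeff hι fun x h => (coeff_tropPoly_eq_zero v).1 (hx x h)]
      exact hf
    · funext e
      rw [coeff_tropPoly, tropVec]
  | zero => exact Submodule.zero_mem _
  | add F G _ _ hF hG =>
    have hx' := fun x hxe => coeff_eq_zero_of_add (hx x hxe)
    exact Submodule.add_mem _ (hF fun x hxe => (hx' x hxe).1) (hG fun x hxe => (hx' x hxe).2)
  | smul c F _ hF =>
    by_cases hc : c = 0
    · simp only [hc, zero_smul]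
      exact Submodule.zero_mem _
    · exact Submodule.smul_mem _ c (hF fun x hxe => (mul_eq_zero.1 (hx x hxe)).resolve_left hc)

theorem mem_tropSpan_vecs_iff {I : Ideal (AddMonoidAlgebra K M)} {E : Type*} [Fintype E]
    {ι : E → M} (hι : Function.Injective ι) {G : E → TropReal} :
    G ∈ tropSpan v (vecs I ι) ↔ ofVec TropReal ι G ∈ tropIdeal v I := by
  refine ⟨ofVec_mem_tropIdeal v hι, fun h => ?_⟩
  have := coeff_mem_tropSpan v hι h fun x hx => coeff_ofVec_of_notMem G hx
  simpa only [coeff_ofVec hι] using this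

/-- An element of the tropical ideal is detected on any finite set containing its support. -/
theorem mem_tropIdeal_iff {I : Ideal (AddMonoidAlgebra K M)} {E : Type*} [Fintype E] {ι : E → M}
    (hι : Function.Injective ι) {F : AddMonoidAlgebra TropReal M}
    (hx : ∀ x, x ∉ Set.range ι → F.coeff x = 0) :
    F ∈ tropIdeal v I ↔ (fun e => F.coeff (ι e)) ∈ tropSpan v (vecs I ι) := by
  rw [mem_tropSpan_vecs_iff v hι, ofVec_coeff hι hx]

/-- The points at which all the tropicalizations of the elements of `I` bend. -/
def tropZeros (I : Ideal (AddMonoidAlgebra K M)) : Set (M → TropReal) :=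
  {y | ∀ f ∈ I, Bends (tropPoly v f).coeff y}

/-- A tropical polynomial lies in the tropical ideal exactly when it bends at all its zeros. -/
theorem mem_tropIdeal_iff_bends {I : Ideal (AddMonoidAlgebra K M)}
    {F : AddMonoidAlgebra TropReal M} :
    F ∈ tropIdeal v I ↔ ∀ y ∈ tropZeros v I, Bends F.coeff y := by
  constructor
  · intro hF y hy
    rw [mem_tropIdeal_iff_span] at hF
    induction hF using Submodule.span_induction with
    | mem F hF =>
      obtain ⟨f, hf, rfl⟩ := hF
      exact hy f hf
    | zero => exact bends_zero y
    | add F G _ _ hF hG => exact hF.add hG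
    | smul c F _ hF => exact hF.smul c
  · intro h
    classical
    -- The window is the support of `F`; there it suffices to bend at the cocircuits.
    let ι : F.coeff.support → M := Subtype.val
    have hι : Function.Injective ι := Subtype.val_injective
    rw [mem_tropIdeal_iff v hι fun x hx => Finsupp.notMem_support_iff.1 fun h => hx ⟨⟨x, h⟩, rfl⟩]
    have hli := (Module.finBasis K (orth (vecs I ι))).linearIndependent.map'
      (orth (vecs I ι)).subtype (Submodule.ker_subtype _)
    rw [mem_tropSpan_iff _ v (span_range_finBasis (orth (vecs I ι)))
      (exists_minorVal_ne_top (v := v) hli)]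
    intro e j u hu
    -- Each cocircuit extends to a linear form vanishing on `I`, whose valuation is a zero of the
    -- tropical ideal.
    obtain ⟨y, hy, hyI⟩ := exists_extension
      ((span_range_finBasis (orth (vecs I ι))).le (cocircuit_mem_span _ e j))
    have hyz : tropVec v y ∈ tropZeros v I := fun f hf => by
      have := bends_of_sum_eq_zero v f.coeff.support f.coeff y
        (fun x hx => Finsupp.mem_support_iff.2 hx) (hyI f hf)
      simp only [← coeff_tropPoly] at this
      exact this
    have hval : ∀ x, tropVec v y (ι x) = Tropical.trop (minorVal v
        (fun i => (Module.finBasis K (orth (vecs I ι)) i : F.coeff.support → K))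
          (Function.update e j x)) := fun x => by
      rw [tropVec, hy, minorVal]
    simp only [← hval] at hu ⊢
    obtain ⟨x, hx, hle⟩ := h _ hyz (ι u) hu
    -- The second small term is finite, so its exponent lies in the window.
    have hx0 : F.coeff x ≠ 0 := fun h0 => by
      rw [h0, zero_mul] at hle
      exact hu (le_antisymm (Tropical.le_zero _) hle)
    exact ⟨⟨x, Finsupp.mem_support_iff.2 hx0⟩, fun h => hx (congrArg ι h), hle⟩

end Ideals

/-! ### Tropical linear forms and deletion of terms -/

section Eval

variable {M : Type*}

/-- The tropical linear form `∑ F_u y_u` in `F`. -/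
noncomputable def pairing (y : M → TropReal) : AddMonoidAlgebra TropReal M →ₗ[TropReal] TropReal :=
  Finsupp.linearCombination TropReal y ∘ₗ (AddMonoidAlgebra.coeffLinearEquiv TropReal).toLinearMap

theorem pairing_apply (y : M → TropReal) (F : AddMonoidAlgebra TropReal M) :
    pairing y F = ∑ u ∈ F.coeff.support, F.coeff u * y u := rfl

theorem pairing_single (y : M → TropReal) (u : M) (c : TropReal) :
    pairing y (AddMonoidAlgebra.single u c) = c * y u :=
  Finsupp.linearCombination_single _ _ _

theorem bends_iff (F : AddMonoidAlgebra TropReal M) (y : M → TropReal) :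
    Bends F.coeff y ↔ ∀ u, pairing y F = pairing y (F.erase u) := by
  classical
  refine forall_congr' fun u => ?_
  -- Splitting off the term at `u` turns the equality into the bound of the remaining minimum by
  -- that term.
  conv_rhs => rw [← AddMonoidAlgebra.single_add_erase u F, map_add, pairing_single,
    AddMonoidAlgebra.single_add_erase u F, Tropical.add_eq_right_iff]
  by_cases h0 : F.coeff u * y u = 0
  · simp only [h0, ne_eq, not_true_eq_false, false_imp_iff, true_iff]
    exact Tropical.le_zero _
  · rw [pairing_apply, sum_le_iff _ _ h0]
    simp only [ne_eq, h0, not_false_eq_true, true_imp_iff]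
    constructor
    · rintro ⟨x, hx, hle⟩
      have hx0 : F.coeff x ≠ 0 := fun hx0 => by
        rw [hx0, zero_mul] at hle
        exact h0 (le_antisymm (Tropical.le_zero _) hle)
      refine ⟨x, ?_, ?_⟩
      · rw [AddMonoidAlgebra.coeff_erase, Finsupp.mem_support_iff, Finsupp.erase_ne hx]
        exact hx0
      · rwa [AddMonoidAlgebra.coeff_erase, Finsupp.erase_ne hx]
    · rintro ⟨x, hx, hle⟩
      have hxu : x ≠ u := by
        rintro rfl
        simp at hx
      rw [AddMonoidAlgebra.coeff_erase, Finsupp.erase_ne hxu] at hle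
      exact ⟨x, hxu, hle⟩

theorem erase_eq_self {R : Type*} [Semiring R] {F : AddMonoidAlgebra R M} {u : M}
    (hu : u ∉ F.coeff.support) : F.erase u = F := by
  ext x
  rw [AddMonoidAlgebra.coeff_erase, Finsupp.erase_of_notMem_support hu]

theorem erase_add (F G : AddMonoidAlgebra TropReal M) (u : M) :
    (F + G).erase u = F.erase u + G.erase u := by
  ext x
  simp [Finsupp.erase_add]

theorem erase_smul (c : TropReal) (F : AddMonoidAlgebra TropReal M) (u : M) :
    (c • F).erase u = c • F.erase u := by
  classical
  ext x
  simp [Finsupp.erase_apply]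

theorem erase_single_mul [AddCommMonoid M] [IsCancelAdd M] (a u : M) (r : TropReal)
    (F : AddMonoidAlgebra TropReal M) :
    (AddMonoidAlgebra.single a r * F).erase (a + u) =
      AddMonoidAlgebra.single a r * F.erase u := by
  classical
  ext x
  rw [AddMonoidAlgebra.coeff_erase, Finsupp.erase_apply]
  by_cases hx : ∃ w, a + w = x
  · obtain ⟨w, rfl⟩ := hx
    simp only [AddMonoidAlgebra.coeff_single_mul_add, add_right_inj, AddMonoidAlgebra.coeff_erase,
      Finsupp.erase_apply, mul_ite, mul_zero]
  · push Not at hx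
    rw [AddMonoidAlgebra.coeff_single_mul_of_forall_add_ne _ _ hx,
      AddMonoidAlgebra.coeff_single_mul_of_forall_add_ne _ _ hx, ite_self]

/-- The congruence of all pairs that no multiple of the linear form `y` separates. -/
noncomputable def pairingCon [AddCommMonoid M] (y : M → TropReal) :
    RingCon (AddMonoidAlgebra TropReal M) where
  r F G := ∀ s, pairing y (s * F) = pairing y (s * G)
  iseqv := ⟨fun _ _ => rfl, fun h s => (h s).symm, fun h h' s => (h s).trans (h' s)⟩
  add' h h' s := by rw [mul_add, mul_add, map_add, map_add, h s, h' s]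
  mul' {F G F' G'} h h' s := by
    rw [← mul_assoc, h' (s * F), mul_right_comm, h (s * G'), mul_right_comm, mul_assoc]

theorem pairingCon_apply [AddCommMonoid M] {y : M → TropReal} {F G : AddMonoidAlgebra TropReal M} :
    pairingCon y F G ↔ ∀ s, pairing y (s * F) = pairing y (s * G) := Iff.rfl

end Eval

/-! ### The congruence and the ideal determine each other -/

section Congruence

variable {K : Type*} [Field K] {M : Type*} [AddCommMonoid M]
  {v : AddValuation K (WithTop ℝ)} {I : Ideal (AddMonoidAlgebra K M)}

theorem tropCongruence_erase_of_mem {f : AddMonoidAlgebra K M} (hf : f ∈ I) (u : M) :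
    tropCongruence v I (tropPoly v f) ((tropPoly v f).erase u) := by
  by_cases hu : u ∈ (tropPoly v f).coeff.support
  · exact RingConGen.Rel.of _ _ ⟨f, hf, u, hu, rfl, rfl⟩
  · rw [erase_eq_self hu]
    exact RingCon.refl _ _

variable [IsCancelAdd M]

/-- By linearity only monomial multipliers of a bend relation need checking, and such a multiple is
the bend relation of a monomial multiple of `f`, again in `I`. -/
theorem tropCongruence_le_pairingCon {y : M → TropReal} (hy : y ∈ tropZeros v I) :
    tropCongruence v I ≤ pairingCon y := by
  refine RingCon.ringConGen_le.2 ?_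
  rintro _ _ ⟨f, hf, u, -, rfl, rfl⟩
  rw [pairingCon_apply]
  intro s
  induction s using AddMonoidAlgebra.induction_linear with
  | zero => rw [zero_mul, zero_mul]
  | add s t hs ht => rw [add_mul, add_mul, map_add, map_add, hs, ht]
  | single a r =>
    rw [single_mul_eq_smul, single_mul_eq_smul a r (AddMonoidAlgebra.erase _ _), map_smul, map_smul,
      ← erase_single_mul, ← tropPoly_single_mul]
    rw [(bends_iff _ y).1 (hy _ (I.mul_mem_left _ hf)) (a + u)]

/-- The zeros of the tropical ideal are the linear forms that are compatible with the
congruence. -/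
theorem mem_tropZeros_iff {y : M → TropReal} :
    y ∈ tropZeros v I ↔ ∀ F G, tropCongruence v I F G → pairing y F = pairing y G := by
  refine ⟨fun hy F G h => ?_, fun h f hf => ?_⟩
  · have := pairingCon_apply.1 (tropCongruence_le_pairingCon hy h) 1
    rwa [one_mul, one_mul] at this
  · exact (bends_iff _ y).2 fun u => h _ _ (tropCongruence_erase_of_mem hf u)

/-- The generators of the congruence only concern the elements `tropPoly v f`. Deleting a term is
linear, so the relations pass to all tropical combinations. -/
theorem tropCongruence_erase {F : AddMonoidAlgebra TropReal M} (hF : F ∈ tropIdeal v I) (u : M) :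
    tropCongruence v I F (F.erase u) := by
  rw [mem_tropIdeal_iff_span] at hF
  induction hF using Submodule.span_induction with
  | mem F hF =>
    obtain ⟨f, hf, rfl⟩ := hF
    exact tropCongruence_erase_of_mem hf u
  | zero =>
    rw [AddMonoidAlgebra.erase_zero]
    exact RingCon.refl _ _
  | add F G _ _ hF hG =>
    rw [erase_add]
    exact RingCon.add _ hF hG
  | smul c F _ hF =>
    have hc : ∀ G : AddMonoidAlgebra TropReal M, c • G = AddMonoidAlgebra.single 0 c * G := by
      intro G
      rw [single_mul_eq_smul, ← AddMonoidAlgebra.one_def, one_mul]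
    rw [erase_smul, hc, hc]
    exact RingCon.mul _ (RingCon.refl _ _) hF

variable {K' : Type*} [Field K'] {v' : AddValuation K' (WithTop ℝ)}
  {I' : Ideal (AddMonoidAlgebra K' M)}

theorem tropCongruence_le_of_tropIdeal_le (h : tropIdeal v I ≤ tropIdeal v' I') :
    tropCongruence v I ≤ tropCongruence v' I' := by
  refine RingCon.ringConGen_le.2 ?_
  rintro _ _ ⟨f, hf, u, -, rfl, rfl⟩
  exact tropCongruence_erase (h (Ideal.subset_span ⟨f, hf, rfl⟩)) u

/-- The congruence and the ideal of a scheme-theoretic tropicalization determine each other. -/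
theorem tropCongruence_eq_iff :
    tropCongruence v I = tropCongruence v' I' ↔ tropIdeal v I = tropIdeal v' I' := by
  refine ⟨fun h => ?_, fun h => le_antisymm (tropCongruence_le_of_tropIdeal_le h.le)
    (tropCongruence_le_of_tropIdeal_le h.ge)⟩
  -- The zeros depend on the congruence alone, and the ideal is recovered from them.
  have hz : tropZeros v I = tropZeros v' I' := by
    ext y
    rw [mem_tropZeros_iff, mem_tropZeros_iff, h]
  ext F
  rw [mem_tropIdeal_iff_bends, mem_tropIdeal_iff_bends, hz]

theorem tropSpan_vecs_eq_of_tropIdeal_eq (h : tropIdeal v I = tropIdeal v' I') {E : Type*}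
    [Fintype E] {ι : E → M} (hι : Function.Injective ι) :
    tropSpan v (vecs I ι) = tropSpan v' (vecs I' ι) := by
  ext G
  rw [mem_tropSpan_vecs_iff v hι, mem_tropSpan_vecs_iff v' hι, h]

theorem tropPoly_mem_of_tropSpan_eq {E : Type*} [Fintype E] {ι : E → M}
    (hι : Function.Injective ι) (h : tropSpan v (vecs I ι) = tropSpan v' (vecs I' ι))
    {f : AddMonoidAlgebra K M} (hf : f ∈ I) (hx : ∀ x, x ∉ Set.range ι → f.coeff x = 0) :
    tropPoly v f ∈ tropIdeal v' I' := by
  have hx' : ∀ x, x ∉ Set.range ι → (tropPoly v f).coeff x = 0 := fun x h =>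
    (coeff_tropPoly_eq_zero v).2 (hx x h)
  rw [mem_tropIdeal_iff v' hι hx', ← h, ← mem_tropIdeal_iff v hι hx']
  exact Ideal.subset_span ⟨f, hf, rfl⟩

end Congruence

/-! ### Homogeneous ideals, degree by degree -/

section Homogeneous

variable {n : ℕ} {K K' : Type*} [Field K] [Field K']
  {v : AddValuation K (WithTop ℝ)} {v' : AddValuation K' (WithTop ℝ)}

/-- The exponent vectors of the monomials of degree `d`. -/
abbrev exponent (n d : ℕ) : MonomialsOfDegree n d → (Fin (n + 1) →₀ ℕ) := Subtype.val

theorem exponent_injective (n d : ℕ) : Function.Injective (exponent n d) :=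
  Subtype.val_injective

theorem mem_range_exponent {d : ℕ} {u : Fin (n + 1) →₀ ℕ} :
    u ∈ Set.range (exponent n d) ↔ u.degree = d := by
  simp [exponent]

theorem gradedPieceOrthogonal_eq_orth (J : Ideal (MvPolynomial (Fin (n + 1)) K)) (d : ℕ) :
    gradedPieceOrthogonal J d = orth (vecs J (exponent n d)) := by
  ext y
  constructor
  · intro hy w hw
    have hhom : MvPolynomial.IsHomogeneous (ofVec K (exponent n d) w) d := by
      intro u hu
      by_contra hne
      refine hu (coeff_ofVec_of_notMem w fun h => hne ?_)
      rw [← mem_range_exponent.1 h, Finsupp.degree_eq_weight_one]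
      rfl
    rw [← hy _ hw hhom]
    exact Finset.sum_congr rfl fun u _ => by
      rw [← coeff_ofVec (exponent_injective n d) w u]; rfl
  · intro hy f hf hhom
    refine hy (fun u => AddMonoidAlgebra.coeff f u.1) ?_
    rw [mem_vecs, ofVec_coeff (exponent_injective n d)]
    · exact hf
    · intro x hx
      by_contra hne
      refine hx (mem_range_exponent.2 ?_)
      rw [← hhom hne, Finsupp.degree_eq_weight_one]
      rfl

theorem gradedValuatedMatroid_eq_iff (J : Ideal (MvPolynomial (Fin (n + 1)) K))
    (J' : Ideal (MvPolynomial (Fin (n + 1)) K')) (d : ℕ) :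
    gradedValuatedMatroid v J d = gradedValuatedMatroid v' J' d ↔
      tropSpan v (vecs J (exponent n d)) = tropSpan v' (vecs J' (exponent n d)) := by
  rw [gradedValuatedMatroid, gradedValuatedMatroid, gradedPieceOrthogonal_eq_orth,
    gradedPieceOrthogonal_eq_orth, subspaceValuatedMatroid_orth_eq_iff]

/-- `tropPoly` is not additive in general, but distinct homogeneous components have disjoint
supports. -/
theorem tropPoly_eq_sum_homogeneousComponent (f : MvPolynomial (Fin (n + 1)) K) :
    tropPoly v f = ∑ i ∈ Finset.range (f.totalDegree + 1),
      tropPoly v (MvPolynomial.homogeneousComponent i f) := by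
  refine AddMonoidAlgebra.ext (Finsupp.ext fun u => ?_)
  have h : ∀ i, (tropPoly v (MvPolynomial.homogeneousComponent i f)).coeff u =
      if u.degree = i then (tropPoly v f).coeff u else 0 := fun i => by
    rw [coeff_tropPoly]
    change Tropical.trop (v (MvPolynomial.coeff u _)) = _
    rw [MvPolynomial.coeff_homogeneousComponent]
    split_ifs
    · rw [coeff_tropPoly]; rfl
    · rw [AddValuation.map_zero, Tropical.trop_top]
  rw [AddMonoidAlgebra.coeff_sum, Finsupp.finsetSum_apply, Finset.sum_congr rfl fun i _ => h i,
    Finset.sum_ite_eq]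
  split_ifs with hu
  · rfl
  · rw [coeff_tropPoly_eq_zero]
    by_contra hne
    refine hu (Finset.mem_range.2 (Nat.lt_succ_of_le ?_))
    exact MvPolynomial.le_totalDegree (Finsupp.mem_support_iff.2 hne)

theorem tropIdeal_le_of_forall_tropSpan_eq {J : Ideal (MvPolynomial (Fin (n + 1)) K)}
    {J' : Ideal (MvPolynomial (Fin (n + 1)) K')}
    (hJ : J.IsHomogeneous (MvPolynomial.homogeneousSubmodule (Fin (n + 1)) K))
    (h : ∀ d, tropSpan v (vecs J (exponent n d)) = tropSpan v' (vecs J' (exponent n d))) :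
    tropIdeal v J ≤ tropIdeal v' J' := by
  refine Ideal.span_le.2 ?_
  rintro _ ⟨f, hf, rfl⟩
  rw [tropPoly_eq_sum_homogeneousComponent]
  refine Ideal.sum_mem _ fun i _ => ?_
  refine tropPoly_mem_of_tropSpan_eq (exponent_injective n i) (h i)
    (MvPolynomial.homogeneousComponent_mem_of_mem hJ hf i) fun x hx => ?_
  change MvPolynomial.coeff x _ = 0
  rw [MvPolynomial.coeff_homogeneousComponent, if_neg fun h => hx (mem_range_exponent.2 h)]

theorem tropIdeal_eq_iff_of_isHomogeneous {J : Ideal (MvPolynomial (Fin (n + 1)) K)}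
    {J' : Ideal (MvPolynomial (Fin (n + 1)) K')}
    (hJ : J.IsHomogeneous (MvPolynomial.homogeneousSubmodule (Fin (n + 1)) K))
    (hJ' : J'.IsHomogeneous (MvPolynomial.homogeneousSubmodule (Fin (n + 1)) K')) :
    tropIdeal v J = tropIdeal v' J' ↔
      ∀ d, gradedValuatedMatroid v J d = gradedValuatedMatroid v' J' d := by
  simp only [gradedValuatedMatroid_eq_iff]
  exact ⟨fun h d => tropSpan_vecs_eq_of_tropIdeal_eq h (exponent_injective n d), fun h =>
    le_antisymm (tropIdeal_le_of_forall_tropSpan_eq hJ h)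
      (tropIdeal_le_of_forall_tropSpan_eq hJ' fun d => (h d).symm)⟩

end Homogeneous

/-! ### Laurent ideals and their homogenizations -/

section Laurent

variable {n : ℕ} {K K' : Type*} [Field K] [Field K']
  {v : AddValuation K (WithTop ℝ)} {v' : AddValuation K' (WithTop ℝ)}

/-- Exponent vectors of polynomials as exponent vectors of Laurent polynomials. -/
noncomputable def intExponent (n : ℕ) : (Fin n →₀ ℕ) →+ (Fin n →₀ ℤ) :=
  Finsupp.mapRange.addMonoidHom (Nat.castAddMonoidHom ℤ)

theorem intExponent_apply (u : Fin n →₀ ℕ) (i : Fin n) : intExponent n u i = u i := rfl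

theorem intExponent_injective (n : ℕ) : Function.Injective (intExponent n) := fun u w h => by
  ext i
  have := DFunLike.congr_fun h i
  rwa [intExponent_apply, intExponent_apply, Nat.cast_inj] at this

/-- The effect on exponents of setting `x₀ = 1`. -/
noncomputable def dehomExponent (n : ℕ) : (Fin (n + 1) →₀ ℕ) →+ (Fin n →₀ ℤ) where
  toFun u := intExponent n u.tail
  map_zero' := by ext; simp [intExponent_apply, Finsupp.tail_apply]
  map_add' u w := by ext; simp [intExponent_apply, Finsupp.tail_apply]

theorem dehomExponent_apply (u : Fin (n + 1) →₀ ℕ) : dehomExponent n u = intExponent n u.tail := rfl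

theorem degree_eq_add_degree_tail (u : Fin (n + 1) →₀ ℕ) : u.degree = u 0 + u.tail.degree := by
  simp [Finsupp.degree_eq_sum, Fin.sum_univ_succ, Finsupp.tail_apply]

/-- The fixed total degree recovers the exponent of `x₀`. -/
theorem tail_exponent_injective (n d : ℕ) :
    Function.Injective fun u : MonomialsOfDegree n d => u.1.tail := by
  intro u w h
  have hu := degree_eq_add_degree_tail u.1
  have hw := degree_eq_add_degree_tail w.1
  have h : u.1.tail = w.1.tail := h
  rw [u.2] at hu
  rw [w.2, ← h] at hw
  refine Subtype.ext ?_
  rw [← Finsupp.cons_tail u.1, ← Finsupp.cons_tail w.1, h, show u.1 0 = w.1 0 by omega]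

theorem exists_exponent {d : ℕ} {u : Fin n →₀ ℕ} (hu : u.degree ≤ d) :
    ∃ m : MonomialsOfDegree n d, m.1 = Finsupp.cons (d - u.degree) u :=
  ⟨⟨Finsupp.cons (d - u.degree) u, by
    rw [degree_eq_add_degree_tail, Finsupp.cons_zero, Finsupp.tail_cons, Nat.sub_add_cancel hu]⟩,
    rfl⟩

/-- The exponent vectors of the dehomogenizations of the monomials of degree `d`. -/
noncomputable def laurentExponent (n d : ℕ) (u : MonomialsOfDegree n d) : Fin n →₀ ℤ :=
  dehomExponent n u.1

theorem laurentExponent_injective (n d : ℕ) : Function.Injective (laurentExponent n d) :=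
  (intExponent_injective n).comp (tail_exponent_injective n d)

theorem toMvLaurent_monomial (u : Fin n →₀ ℕ) (c : K) :
    toMvLaurent (MvPolynomial.monomial u c) = AddMonoidAlgebra.single (intExponent n u) c := by
  have h : toMvLaurent = AddMonoidAlgebra.mapDomainAlgHom K K (intExponent n) := by
    refine MvPolynomial.algHom_ext fun i => ?_
    rw [toMvLaurent, MvPolynomial.aeval_X, MvPolynomial.X, ← MvPolynomial.single_eq_monomial,
      AddMonoidAlgebra.mapDomainAlgHom_apply, AddMonoidAlgebra.mapDomain_single]
    congr 1
    simp [intExponent]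
  rw [h, ← MvPolynomial.single_eq_monomial, AddMonoidAlgebra.mapDomainAlgHom_apply,
    AddMonoidAlgebra.mapDomain_single]

/-- The substitution `x₀ = 1`. -/
noncomputable def dehomogenize (n : ℕ) (K : Type*) [Field K] :
    MvPolynomial (Fin (n + 1)) K →ₐ[K] MvLaurent n K :=
  AddMonoidAlgebra.mapDomainAlgHom K K (dehomExponent n)

theorem dehomogenize_single (u : Fin (n + 1) →₀ ℕ) (c : K) :
    dehomogenize n K (AddMonoidAlgebra.single u c) =
      AddMonoidAlgebra.single (dehomExponent n u) c := by
  rw [dehomogenize, AddMonoidAlgebra.mapDomainAlgHom_apply, AddMonoidAlgebra.mapDomain_single]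

theorem dehomogenize_homogenization (f : MvPolynomial (Fin n) K) :
    dehomogenize n K (homogenization f) = toMvLaurent f := by
  conv_rhs => rw [← MvPolynomial.support_sum_monomial_coeff f]
  rw [homogenization, map_sum, map_sum]
  refine Finset.sum_congr rfl fun u _ => ?_
  rw [← MvPolynomial.single_eq_monomial, dehomogenize_single, toMvLaurent_monomial,
    dehomExponent_apply, Finsupp.tail_cons]

theorem homogenizationIdeal_le (I : Ideal (MvLaurent n K)) :
    homogenizationIdeal I ≤ I.comap (dehomogenize n K) := by
  refine Ideal.span_le.2 ?_
  rintro _ ⟨f, hf, rfl⟩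
  rw [SetLike.mem_coe, Ideal.mem_comap, dehomogenize_homogenization]
  exact hf

/-- A form of degree `d` is a power of `x₀` times the homogenization of its dehomogenization `f`,
the power making up for `f.totalDegree` being possibly less than `d`. -/
theorem ofVec_exponent_eq {d : ℕ} (w : MonomialsOfDegree n d → K) :
    ∃ f : MvPolynomial (Fin n) K, toMvLaurent f = ofVec K (laurentExponent n d) w ∧
      ∃ g, ofVec K (exponent n d) w = g * homogenization f := by
  classical
  have hinj := tail_exponent_injective n d
  let f : MvPolynomial (Fin n) K := ofVec K (fun u : MonomialsOfDegree n d => u.1.tail) w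
  have hcoeff : ∀ m : MonomialsOfDegree n d, MvPolynomial.coeff m.1.tail f = w m :=
    fun m => coeff_ofVec hinj w m
  have hsupp : ∀ u ∈ f.support, ∃ m : MonomialsOfDegree n d, m.1.tail = u := fun u hu => by
    by_contra hcon
    exact MvPolynomial.mem_support_iff.1 hu (coeff_ofVec_of_notMem w hcon)
  have hdeg : f.totalDegree ≤ d := by
    refine Finset.sup_le fun u hu => ?_
    obtain ⟨m, rfl⟩ := hsupp u hu
    change m.1.tail.degree ≤ d
    have := degree_eq_add_degree_tail m.1
    rw [m.2] at this
    omega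
  refine ⟨f, ?_, MvPolynomial.monomial (Finsupp.single 0 (d - f.totalDegree)) 1, ?_⟩
  · rw [ofVec_apply]
    change toMvLaurent (∑ u : MonomialsOfDegree n d, MvPolynomial.monomial u.1.tail (w u)) = _
    rw [map_sum]
    exact Finset.sum_congr rfl fun u _ => toMvLaurent_monomial _ _
  · rw [homogenization, Finset.mul_sum, ofVec_apply,
      ← Finset.sum_filter_of_ne (p := fun u => w u ≠ 0) (fun u _ hu h0 => hu (by simp [h0]))]
    refine Finset.sum_of_injOn (fun u => u.1.tail) hinj.injOn (fun m hm => ?_)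
      (fun u hu hu' => ?_) fun m hm => ?_
    · rw [Finset.mem_coe, MvPolynomial.mem_support_iff, hcoeff]
      exact (Finset.mem_filter.1 hm).2
    · obtain ⟨m, rfl⟩ := hsupp u hu
      refine absurd ⟨m, ?_, rfl⟩ hu'
      rw [MvPolynomial.mem_support_iff, hcoeff] at hu
      simpa using hu
    · have hm' : m.1.tail ∈ f.support := by
        rw [MvPolynomial.mem_support_iff, hcoeff]
        exact (Finset.mem_filter.1 hm).2
      -- With `hdeg`, this makes both truncated subtractions in the exponent of `x₀` exact.
      have hle : m.1.tail.degree ≤ f.totalDegree := MvPolynomial.le_totalDegree hm'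
      have hd := degree_eq_add_degree_tail m.1
      rw [m.2] at hd
      rw [MvPolynomial.monomial_mul, one_mul, hcoeff, MvPolynomial.single_eq_monomial]
      congr 2
      ext i
      refine Fin.cases ?_ (fun i => ?_) i
      · simp only [Finsupp.add_apply, Finsupp.single_eq_same, Finsupp.cons_zero, exponent]
        omega
      · simp [Finsupp.tail_apply]

/-- Setting `x₀ = 1` maps the homogenization into `I`; conversely `ofVec_exponent_eq` makes a form
whose dehomogenization lies in `I` a multiple of a generator. -/
theorem vecs_homogenizationIdeal (I : Ideal (MvLaurent n K)) (d : ℕ) :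
    vecs (homogenizationIdeal I) (exponent n d) = vecs I (laurentExponent n d) := by
  ext w
  rw [mem_vecs, mem_vecs]
  constructor
  · intro h
    have h1 := homogenizationIdeal_le I h
    rw [Ideal.mem_comap, ofVec_apply, map_sum] at h1
    simp only [dehomogenize_single] at h1
    exact h1
  · intro h
    obtain ⟨f, hf, g, hg⟩ := ofVec_exponent_eq w
    rw [hg]
    refine Ideal.mul_mem_left _ _ (Ideal.subset_span ⟨f, ?_, rfl⟩)
    rw [Set.mem_ofPred_eq, hf]
    exact h

theorem exists_shift (s : Finset (Fin n →₀ ℤ)) :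
    ∃ (a : Fin n →₀ ℤ) (d : ℕ), ∀ u ∈ s, a + u ∈ Set.range (laurentExponent n d) := by
  -- Each coordinate of `a` is at least `|u i|` for every `u ∈ s`, so all `a + u` are nonnegative;
  -- `d` is then the largest of their degrees.
  let a : Fin n →₀ ℤ := ∑ u ∈ s, intExponent n (u.mapRange Int.natAbs rfl)
  let t : (Fin n →₀ ℤ) → (Fin n →₀ ℕ) := fun u => (a + u).mapRange Int.toNat rfl
  refine ⟨a, s.sup fun u => (t u).degree, fun u hu => ?_⟩
  obtain ⟨m, hm⟩ := exists_exponent (Finset.le_sup (f := fun u => (t u).degree) hu)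
  refine ⟨m, ?_⟩
  rw [laurentExponent, dehomExponent_apply, hm, Finsupp.tail_cons]
  ext i
  rw [intExponent_apply, Finsupp.mapRange_apply]
  refine Int.toNat_of_nonneg ?_
  have h1 : ((u i).natAbs : ℤ) ≤ a i := by
    rw [Finsupp.finsetSum_apply]
    exact Finset.single_le_sum (f := fun u : Fin n →₀ ℤ =>
      intExponent n (u.mapRange Int.natAbs rfl) i) (fun _ _ => Int.natCast_nonneg _) hu
  rw [Finsupp.add_apply]
  omega

theorem tropIdeal_le_of_forall_tropSpan_laurent_eq {I : Ideal (MvLaurent n K)}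
    {I' : Ideal (MvLaurent n K')}
    (h : ∀ d, tropSpan v (vecs I (laurentExponent n d)) =
      tropSpan v' (vecs I' (laurentExponent n d))) :
    tropIdeal v I ≤ tropIdeal v' I' := by
  refine Ideal.span_le.2 ?_
  rintro _ ⟨f, hf, rfl⟩
  obtain ⟨a, d, had⟩ := exists_shift f.coeff.support
  have hmem : tropPoly v (AddMonoidAlgebra.single a 1 * f) ∈ tropIdeal v' I' := by
    refine tropPoly_mem_of_tropSpan_eq (laurentExponent_injective n d) (h d)
      (I.mul_mem_left _ hf) fun x hx => ?_
    have hxa : x = a + (-a + x) := by abel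
    rw [hxa, AddMonoidAlgebra.coeff_single_mul_add, one_mul]
    by_contra hne
    exact hx (hxa ▸ had _ (Finsupp.mem_support_iff.2 hne))
  -- Laurent monomials are units, so the shift into the window can be undone.
  have := (tropIdeal v' I').mul_mem_left (AddMonoidAlgebra.single (-a) 1) hmem
  rwa [tropPoly_single_mul, ← mul_assoc, AddMonoidAlgebra.single_mul_single, neg_add_cancel,
    one_mul, ← AddMonoidAlgebra.one_def, one_mul] at this

theorem tropIdeal_eq_iff_of_laurent {I : Ideal (MvLaurent n K)} {I' : Ideal (MvLaurent n K')} :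
    tropIdeal v I = tropIdeal v' I' ↔
      ∀ d, gradedValuatedMatroid v (homogenizationIdeal I) d =
        gradedValuatedMatroid v' (homogenizationIdeal I') d := by
  simp only [gradedValuatedMatroid_eq_iff, vecs_homogenizationIdeal]
  exact ⟨fun h d => tropSpan_vecs_eq_of_tropIdeal_eq h (laurentExponent_injective n d), fun h =>
    le_antisymm (tropIdeal_le_of_forall_tropSpan_laurent_eq h)
      (tropIdeal_le_of_forall_tropSpan_laurent_eq fun d => (h d).symm)⟩

end Laurent

end Tropicalization

/-- Each of the three objects attached to an ideal determines the other two: if they agree in one of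
the three for two ideals, over possibly different valued fields, then they agree in all three. -/
theorem theorem1p1 (n : ℕ) {K K' : Type*} [Field K] [Field K']
    (v : AddValuation K (WithTop ℝ)) (v' : AddValuation K' (WithTop ℝ)) :
    (∀ (I : Ideal (MvLaurent n K)) (I' : Ideal (MvLaurent n K')),
      [tropCongruence v I = tropCongruence v' I',
        tropIdeal v I = tropIdeal v' I',
        ∀ d : ℕ, gradedValuatedMatroid v (homogenizationIdeal I) d =
          gradedValuatedMatroid v' (homogenizationIdeal I') d].TFAE) ∧
    (∀ (I : Ideal (MvPolynomial (Fin (n + 1)) K)) (I' : Ideal (MvPolynomial (Fin (n + 1)) K')),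
      I.IsHomogeneous (MvPolynomial.homogeneousSubmodule (Fin (n + 1)) K) →
      I'.IsHomogeneous (MvPolynomial.homogeneousSubmodule (Fin (n + 1)) K') →
      [tropCongruence v I = tropCongruence v' I',
        tropIdeal v I = tropIdeal v' I',
        ∀ d : ℕ, gradedValuatedMatroid v I d = gradedValuatedMatroid v' I' d].TFAE) := by
  refine ⟨fun I I' => ?_, fun I I' hI hI' => ?_⟩
  · tfae_have 1 ↔ 2 := Tropicalization.tropCongruence_eq_iff
    tfae_have 2 ↔ 3 := Tropicalization.tropIdeal_eq_iff_of_laurent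
    tfae_finish
  · tfae_have 1 ↔ 2 := Tropicalization.tropCongruence_eq_iff
    tfae_have 2 ↔ 3 := Tropicalization.tropIdeal_eq_iff_of_isHomogeneous hI hI'
    tfae_finish
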